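/- Let $k$ be an algebraically closed field of characteristic $0$. Let $1\le a\le b$ be integers such that $a$ and $b$ both divide $d:=1+1+a+b$ (that is, $(a,b)\in\{(1,1),(1,3),(2,2),(2,4),(4,6)\}$), put $(a_0,a_1,a_2,a_3)=(1,1,a,b)$ and $h_i=d/a_i$. Let $q_{ij}\in k^\times$ $(0\le i,j\le 3)$ satisfy $q_{ii}=q_{ij}q_{ji}=1$ and $q_{ij}^{h_i}=q_{ij}^{h_j}=1$ for all $i,j$. Let $$C=k\langle x_0,x_1,x_2,x_3\rangle/(x_jx_i-q_{ji}x_ix_j)_{i,j},\qquad \deg x_i=a_i,\qquad f=\sum_{i=0}^{3}x_i^{h_i}.$$ For a graded algebra $A$ let $\mathrm{gr}(A)$ be the category of finitely generated $\mathbb Z$-graded right $A$-modules, and let $\mathrm{qgr}(A)=\mathrm{gr}(A)/\mathrm{tor}(A)$ be its quotient by the torsion modules (those in which every element is annihilated by $A_{\ge s}$ for some $s$), with projection $\pi:\mathrm{gr}(A)\to\mathrm{qgr}(A)$. A module $M\in\mathrm{gr}(A)$ is $1$-critical if it has Gelfand--Kirillov dimension $1$ and every quotient of $M$ by a nonzero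 graded submodule has Gelfand--Kirillov dimension $<1$; its multiplicity is $\lim_{t\to1^-}(1-t)\sum_i(\dim_k M_i)t^i$. An ordinary (respectively thin) closed point of $\mathrm{proj}(A)$ is an isomorphism class of objects of $\mathrm{qgr}(A)$ that contains $\pi M$ for some $1$-critical $M\in\mathrm{gr}(A)$ of multiplicity $1$ (respectively $<1$). If the set of ordinary and thin closed points of $\mathrm{proj}(C/(f))$ is finite, then it has exactly $24$ elements. (This holds in particular for every such $(q_{ij})$ for which $\mathrm{proj}(C/(f))$ is a projective Calabi--Yau surface, i.e. has global dimension $2$ and the shift $[2]$ as the Serre functor of $D^b(\mathrm{qgr}(C/(f)))$.) -/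

import Mathlib

open CategoryTheory MulOpposite Filter Topology

universe u

noncomputable section

namespace QuantumWeighted

/-! ### Graded right modules and the quotient category `qgr`

`A` is a `k`-algebra and `𝒜 : ℕ → Submodule k A` is its grading.  Right `A`-modules are modules
over `Aᵐᵒᵖ`. -/

section Graded

variable (k : Type u) [Field k] {A : Type u} [Ring A] [Algebra k A] (𝒜 : ℕ → Submodule k A)

/-- A finitely generated `ℤ`-graded right `A`-module. -/
structure GrMod where
  carrier : Type u
  [addCommGroup : AddCommGroup carrier]
  [moduleBase : Module k carrier]
  [module : Module Aᵐᵒᵖ carrier]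
  [isScalarTower : IsScalarTower k Aᵐᵒᵖ carrier]
  /-- the homogeneous component `M_i` -/
  deg : ℤ → Submodule k carrier
  isInternal : DirectSum.IsInternal deg
  /-- `M_i A_j ⊆ M_{i+j}` -/
  smul_mem : ∀ (i : ℤ) (j : ℕ) (m : carrier) (r : A),
    m ∈ deg i → r ∈ 𝒜 j → op r • m ∈ deg (i + j)
  finite : Module.Finite Aᵐᵒᵖ carrier

attribute [instance] GrMod.addCommGroup GrMod.moduleBase GrMod.module GrMod.isScalarTower

variable {k} {𝒜}

/-- Morphisms in `gr(A)`: right `A`-linear maps of degree zero. -/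
@[ext]
structure GrMod.Hom (M N : GrMod k 𝒜) where
  toLin : M.carrier →ₗ[Aᵐᵒᵖ] N.carrier
  map_deg : ∀ (i : ℤ) (m : M.carrier), m ∈ M.deg i → toLin m ∈ N.deg i

/-- The category `gr(A)` of finitely generated graded right `A`-modules. -/
instance : Category (GrMod k 𝒜) where
  Hom := GrMod.Hom
  id M := ⟨LinearMap.id, fun _ _ h => h⟩
  comp f g := ⟨g.toLin ∘ₗ f.toLin, fun i m h => g.map_deg i _ (f.map_deg i m h)⟩

variable (k 𝒜) in
/-- The degree-zero maps whose kernel and cokernel are torsion, where a module is torsion if each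
of its elements is annihilated by `A_{≥ s}` for some `s`. -/
def torsionIso : MorphismProperty (GrMod k 𝒜) := fun M N f =>
  (∀ m : M.carrier, GrMod.Hom.toLin f m = 0 →
      ∃ s : ℕ, ∀ j ≥ s, ∀ r ∈ 𝒜 j, op r • m = 0) ∧
  (∀ n : N.carrier,
      ∃ s : ℕ, ∀ j ≥ s, ∀ r ∈ 𝒜 j, op r • n ∈ LinearMap.range (GrMod.Hom.toLin f))

variable (k 𝒜) in
/-- The quotient category `qgr(A) = gr(A)/tor(A)`, as the localization of `gr(A)` at the maps with
torsion kernel and torsion cokernel. -/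
abbrev Qgr := (torsionIso k 𝒜).Localization

variable (k 𝒜) in
/-- The projection `π : gr(A) ⥤ qgr(A)`. -/
abbrev proj : GrMod k 𝒜 ⥤ Qgr k 𝒜 := (torsionIso k 𝒜).Q

namespace GrMod

/-- The Hilbert function `i ↦ dim_k M_i`. -/
def hilb (M : GrMod k 𝒜) (i : ℤ) : ℕ := Module.finrank k (M.deg i)

/-- The Gelfand–Kirillov dimension of a finitely generated graded module,
`limsup_n log (∑_{|i| ≤ n} dim M_i) / log n`. -/
def gkdim (M : GrMod k 𝒜) : EReal :=
  limsup (fun n : ℕ =>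
    ((Real.log (∑ i ∈ Finset.Icc (-(n : ℤ)) n, (M.hilb i : ℝ)) / Real.log n : ℝ) : EReal)) atTop

/-- `M` is `1`-critical: it has GK-dimension `1`, and each of its quotients by a nonzero graded
submodule has GK-dimension `< 1`. -/
def IsOneCritical (M : GrMod k 𝒜) : Prop :=
  M.gkdim = 1 ∧
  ∀ (P : GrMod k 𝒜) (p : M ⟶ P), Function.Surjective (GrMod.Hom.toLin p) →
    ¬ Function.Injective (GrMod.Hom.toLin p) → P.gkdim < 1

/-- The module `M` of GK-dimension `1` has multiplicity `e = lim_{t → 1⁻} (1 - t) H_M(t)`, where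
`H_M(t) = ∑ (dim M_i) t^i` is the Hilbert series. -/
def HasMultiplicity (M : GrMod k 𝒜) (e : ℝ) : Prop :=
  Tendsto (fun t : ℝ => (1 - t) * ∑' i : ℤ, (M.hilb i : ℝ) * t ^ i) (𝓝[<] 1) (𝓝 e)

end GrMod

variable (k 𝒜) in
/-- The set of ordinary (multiplicity `1`) and thin (multiplicity `< 1`) closed points of
`proj(A)`: the isomorphism classes of objects of `qgr(A)` that are represented by a finitely
generated `1`-critical module of multiplicity at most `1`. -/
def ordinaryThinPoints : Set (Quotient (isIsomorphicSetoid (Qgr k 𝒜))) :=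
  {x | ∃ M : GrMod k 𝒜, M.IsOneCritical ∧ (∃ e : ℝ, M.HasMultiplicity e ∧ e ≤ 1) ∧
    x = Quotient.mk (isIsomorphicSetoid (Qgr k 𝒜)) ((proj k 𝒜).obj M)}

end Graded

/-! ### Quantum weighted hypersurfaces -/

section Hypersurface

variable {k : Type u} [Field k] {n : ℕ} (w : Fin n → ℕ) (q : Fin n → Fin n → k)

/-- The exponent `h_i = d / a_i`, where `d` is the sum of the weights. -/
def expo (i : Fin n) : ℕ := (∑ j, w j) / w i

/-- The relations `x_j x_i = q_{ji} x_i x_j` and `f = ∑ x_i ^ h_i = 0`. -/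
inductive Rel : FreeAlgebra k (Fin n) → FreeAlgebra k (Fin n) → Prop
  | comm (i j : Fin n) :
      Rel (FreeAlgebra.ι k j * FreeAlgebra.ι k i)
        (q j i • (FreeAlgebra.ι k i * FreeAlgebra.ι k j))
  | hyp : Rel (∑ i, FreeAlgebra.ι k i ^ expo w i) 0

/-- The algebra `C/(f)`, with `C = k⟨x_i⟩/(x_j x_i - q_{ji} x_i x_j)` and `f = ∑ x_i ^ h_i`. -/
abbrev HypAlg : Type u := RingQuot (Rel w q)

/-- The generator `x_i` of `C/(f)`. -/
def gen (i : Fin n) : HypAlg w q := RingQuot.mkAlgHom k (Rel w q) (FreeAlgebra.ι k i)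

/-- The grading of `C/(f)` with `deg x_i = w i`: the component of degree `m` is spanned by the
words of total weight `m` in the generators. -/
def hypGrading (m : ℕ) : Submodule k (HypAlg w q) :=
  Submodule.span k {y | ∃ l : List (Fin n), (l.map w).sum = m ∧ y = (l.map (gen w q)).prod}

end Hypersurface

end QuantumWeighted

end

noncomputable section

namespace QuantumWeighted

/-! ### Homogeneous components of a graded module -/

section Graded

variable {k : Type u} [Field k] {A : Type u} [Ring A] [Algebra k A] {𝒜 : ℕ → Submodule k A}

/-! Let `M` be a 1-critical module of multiplicity at most 1. Each x_i commutes with every word up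
to a nonzero scalar, so its kernel on `M` is a graded submodule, and criticality leaves two cases:
x_i kills `M`, or it is injective on homogeneous elements ("active";
`GrMod.IsOneCritical.gen_smul_eq_zero_or`). Since f acts as zero, at least two generators are
active.

Three active generators contradict finiteness. Any three of the four variables include one of weight
1; an active generator of weight 1 together with multiplicity at most 1 forces every component to
have dimension at most 1, so `M` is described in large degrees by scalars. The powers x_i^{h_i} are
central because q_{ji}^{h_i} = 1, hence their eigenvalues on an active support have constant ratios,
and f = 0 is one linear condition on these ratios. With three of them, rescaling the generators
moves the point in an infinite family (`PointData.infinite_of_three_active`).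

So exactly two generators x_i, x_j with i < j are active. If w_i divides w_j, then x_i^{w_j/w_i} is
bijective in large degrees, and an eigenvector of x_j relative to it spans a module with basis e_s
on which x_i acts by e_s → e_{s+1} and x_j by μ q_{ij}^s. The relation f = 0 becomes μ^{h_j} =
constant, which has h_j solutions. The only other pair of weights is (4,6), where q_{ij} = 1 and
x_j^2 = -x_i^3, as on a cuspidal cubic, and a single normal form remains. In both cases the degrees
fill one residue class modulo gcd(w_i, w_j). The count is therefore the sum over i < j of gcd(w_i,
w_j) times h_j (or times 1 for the pair (4,6)), and this is 24 for each of the five weight vectors.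

To separate points without computing morphisms in the quotient category, fix z and degrees δ_t → ∞:
whether z kills `M` in degree δ_t, up to torsion and for large t, depends only on the isomorphism
class (`eventually_isTors_of_iso`). The choice z = x_l detects the active pair, z = 1 the residue
class, z = x_j - μ x_i^{w_j/w_i} the parameter, and a combination of two powers x_i^{h_i} the
members of the infinite family. -/

lemma GrMod.iSup_deg (M : GrMod k 𝒜) : ⨆ i, M.deg i = ⊤ :=
  M.isInternal.submodule_iSup_eq_top

/-- The projection of a graded module onto its component of degree `i`. -/
def GrMod.pr (M : GrMod k 𝒜) (i : ℤ) : M.carrier →ₗ[k] M.carrier :=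
  (M.deg i).subtype ∘ₗ DirectSum.component k ℤ (fun i => M.deg i) i ∘ₗ
    (LinearEquiv.ofBijective (DirectSum.coeLinearMap M.deg) M.isInternal).symm.toLinearMap

lemma GrMod.pr_mem (M : GrMod k 𝒜) (i : ℤ) (m : M.carrier) : M.pr i m ∈ M.deg i :=
  Subtype.property _

lemma GrMod.pr_apply_of_mem (M : GrMod k 𝒜) {i j : ℤ} {m : M.carrier} (hm : m ∈ M.deg j) :
    M.pr i m = if j = i then m else 0 := by
  have h : (LinearEquiv.ofBijective (DirectSum.coeLinearMap M.deg) M.isInternal).symm m =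
      DirectSum.lof k ℤ (fun i => M.deg i) j ⟨m, hm⟩ := by
    rw [LinearEquiv.symm_apply_eq]
    exact (DirectSum.coeLinearMap_lof M.deg j ⟨m, hm⟩).symm
  simp only [GrMod.pr, LinearMap.comp_apply, LinearEquiv.coe_coe, h]
  split_ifs with hij
  · subst hij
    simp [DirectSum.component.lof_self]
  · rw [DirectSum.component.of, dif_neg hij]
    simp

lemma GrMod.pr_of_mem (M : GrMod k 𝒜) {i : ℤ} {m : M.carrier} (hm : m ∈ M.deg i) :
    M.pr i m = m := by rw [M.pr_apply_of_mem hm, if_pos rfl]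

lemma GrMod.pr_of_mem_ne (M : GrMod k 𝒜) {i j : ℤ} {m : M.carrier} (hm : m ∈ M.deg j)
    (h : j ≠ i) : M.pr i m = 0 := by rw [M.pr_apply_of_mem hm, if_neg h]

lemma GrMod.induction_homogeneous (M : GrMod k 𝒜) {motive : M.carrier → Prop}
    (hom : ∀ i, ∀ m ∈ M.deg i, motive m) (add : ∀ x y, motive x → motive y → motive (x + y))
    (m : M.carrier) : motive m :=
  Submodule.iSup_induction M.deg (x := m) (by rw [M.iSup_deg]; trivial) hom
    (hom 0 0 (zero_mem _)) add

lemma GrMod.mem_span_pr (M : GrMod k 𝒜) (m : M.carrier) :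
    m ∈ Submodule.span k (Set.range fun i => M.pr i m) := by
  classical
  let e := LinearEquiv.ofBijective (DirectSum.coeLinearMap M.deg) M.isInternal
  obtain ⟨s, rfl⟩ := e.surjective m
  have h : ∀ i, M.pr i (e s) = s i := fun i => by
    simp only [GrMod.pr, LinearMap.comp_apply, LinearEquiv.coe_coe]
    change (M.deg i).subtype (DirectSum.component k ℤ _ i (e.symm (e s))) = _
    rw [e.symm_apply_apply]
    rfl
  have h2 : e s = ∑ i ∈ DFinsupp.support s, (s i : M.carrier) := by
    conv_lhs => rw [← DirectSum.sum_support_of s]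
    rw [map_sum]
    refine Finset.sum_congr rfl fun i _ => ?_
    exact DirectSum.coeLinearMap_of M.deg i (s i)
  rw [h2]
  refine sum_mem fun i _ => Submodule.subset_span ⟨i, ?_⟩
  rw [← h2]
  exact h i

lemma GrMod.exists_pr_ne_zero (M : GrMod k 𝒜) {m : M.carrier} (hm : m ≠ 0) :
    ∃ i, M.pr i m ≠ 0 := by
  by_contra! h
  have := M.mem_span_pr m
  simp_rw [h] at this
  simp at this
  exact hm this

lemma iSupIndep_of_projections {ι V : Type*} [AddCommGroup V] [Module k V]
    (D : ι → Submodule k V) (p : ι → V →ₗ[k] V) (hp : ∀ i, ∀ v ∈ D i, p i v = v)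
    (hp0 : ∀ i j, j ≠ i → ∀ v ∈ D j, p i v = 0) : iSupIndep D := by
  intro i
  rw [Submodule.disjoint_def]
  intro v hv hv'
  rw [← hp i v hv]
  have : (⨆ j, ⨆ (_ : j ≠ i), D j) ≤ LinearMap.ker (p i) :=
    iSup₂_le fun j hj v hv => hp0 i j hj v hv
  exact this hv'

/-- Projecting a sum of elements of the `U j` to degree `i` keeps only the `U i` part. This turns a
spanning statement for the whole module into one for each component. -/
lemma GrMod.deg_eq_of_le (M : GrMod k 𝒜) (U : ℤ → Submodule k M.carrier)
    (hU : ∀ i, U i ≤ M.deg i) (htop : ⨆ i, U i = ⊤) (i : ℤ) : U i = M.deg i := by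
  refine le_antisymm (hU i) fun m hm => ?_
  suffices h : ∀ x : M.carrier, M.pr i x ∈ U i by
    rw [← M.pr_of_mem hm]; exact h m
  intro x
  refine Submodule.iSup_induction U (x := x) (by rw [htop]; trivial) ?_ (by simp) ?_
  · intro j y hy
    by_cases h : j = i
    · subst h; rwa [M.pr_of_mem (hU _ hy)]
    · rw [M.pr_of_mem_ne (hU _ hy) h]; exact zero_mem _
  · intro x y hx hy
    rw [map_add]; exact add_mem hx hy

lemma GrMod.Hom.toLin_smul {M N : GrMod k 𝒜} (f : M ⟶ N) (c : k) (m : M.carrier) :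
    GrMod.Hom.toLin f (c • m) = c • GrMod.Hom.toLin f m := by
  rw [← algebraMap_smul Aᵐᵒᵖ c m, map_smul, algebraMap_smul]

lemma GrMod.Hom.toLin_pr {M N : GrMod k 𝒜} (f : M ⟶ N) (i : ℤ) (m : M.carrier) :
    GrMod.Hom.toLin f (M.pr i m) = N.pr i (GrMod.Hom.toLin f m) := by
  induction m using M.induction_homogeneous with
  | hom j m hm =>
    rw [M.pr_apply_of_mem hm, N.pr_apply_of_mem (GrMod.Hom.map_deg f j m hm)]
    split_ifs <;> simp
  | add x y hx hy => simp only [map_add, hx, hy]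

/-- The quotient of a graded module by a graded submodule. -/
def GrMod.quot (M : GrMod k 𝒜) (K : Submodule Aᵐᵒᵖ M.carrier)
    (hK : ∀ i, ∀ m ∈ K, M.pr i m ∈ K) : GrMod k 𝒜 where
  carrier := M.carrier ⧸ K
  deg i := (M.deg i).map (K.mkQ.restrictScalars k)
  isInternal := by
    refine DirectSum.isInternal_submodule_of_iSupIndep_of_iSup_eq_top ?_ ?_
    · refine iSupIndep_of_projections _
        (fun i => Submodule.mapQ (K.restrictScalars k) (K.restrictScalars k) (M.pr i)
          (fun m hm => hK i m hm)) ?_ ?_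
      · rintro i _ ⟨m, hm, rfl⟩
        change Submodule.Quotient.mk (M.pr i m) = _
        rw [M.pr_of_mem hm]; rfl
      · rintro i j hij _ ⟨m, hm, rfl⟩
        change Submodule.Quotient.mk (M.pr i m) = _
        rw [M.pr_of_mem_ne hm hij]; rfl
    · rw [← Submodule.map_iSup, M.iSup_deg, Submodule.map_top, LinearMap.range_eq_top]
      exact K.mkQ_surjective
  smul_mem := by
    rintro i j _ r ⟨m, hm, rfl⟩ hr
    exact ⟨op r • m, M.smul_mem i j m r hm hr, rfl⟩
  finite := by
    have := M.finite
    infer_instance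

/-- The projection onto the quotient by a graded submodule. -/
def GrMod.quotMk (M : GrMod k 𝒜) (K : Submodule Aᵐᵒᵖ M.carrier)
    (hK : ∀ i, ∀ m ∈ K, M.pr i m ∈ K) : M ⟶ M.quot K hK :=
  GrMod.Hom.mk (N := M.quot K hK) K.mkQ (fun _ m hm => ⟨m, hm, rfl⟩)

lemma GrMod.exists_homogeneous_generators (M : GrMod k 𝒜) :
    ∃ G : Finset (ℤ × M.carrier), (∀ p ∈ G, p.2 ∈ M.deg p.1) ∧
      Submodule.span Aᵐᵒᵖ (Prod.snd '' (G : Set (ℤ × M.carrier))) = ⊤ := by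
  classical
  obtain ⟨S, hS⟩ := M.finite.fg_top
  have hfin : ∀ m : M.carrier, ∃ G : Finset (ℤ × M.carrier), (∀ p ∈ G, p.2 ∈ M.deg p.1) ∧
      m ∈ Submodule.span Aᵐᵒᵖ (Prod.snd '' (G : Set (ℤ × M.carrier))) := by
    intro m
    induction m using M.induction_homogeneous with
    | hom i m hm =>
      exact ⟨{(i, m)}, by simpa using hm, Submodule.subset_span ⟨(i, m), by simp, rfl⟩⟩
    | add x y hx hy =>
      obtain ⟨G, hG, hx⟩ := hx
      obtain ⟨G', hG', hy⟩ := hy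
      refine ⟨G ∪ G', fun p hp => ?_, add_mem ?_ ?_⟩
      · rcases Finset.mem_union.1 hp with h | h
        exacts [hG p h, hG' p h]
      · exact Submodule.span_mono (Set.image_mono (by simp)) hx
      · exact Submodule.span_mono (Set.image_mono (by simp)) hy
  choose G hG hm using hfin
  refine ⟨S.biUnion G, ?_, ?_⟩
  · intro p hp
    obtain ⟨m, -, hp⟩ := Finset.mem_biUnion.1 hp
    exact hG m p hp
  · rw [eq_top_iff, ← hS, Submodule.span_le]
    intro m hmS
    refine Submodule.span_mono (Set.image_mono ?_) (hm m)
    intro p hp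
    exact Finset.mem_coe.2 (Finset.mem_biUnion.2 ⟨m, hmS, hp⟩)

end Graded

/-! ### Words in the generators -/

section Algebra

variable {k : Type u} [Field k] {n : ℕ} {w : Fin n → ℕ} {q : Fin n → Fin n → k}

variable (w) in
/-- The weight of a word. -/
def wt (l : List (Fin n)) : ℕ := (l.map w).sum

@[simp] lemma wt_nil : wt w [] = 0 := rfl
@[simp] lemma wt_cons (i : Fin n) (l : List (Fin n)) : wt w (i :: l) = w i + wt w l := by
  simp [wt]
@[simp] lemma wt_append (l l' : List (Fin n)) : wt w (l ++ l') = wt w l + wt w l' := by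
  simp [wt]

variable (w q) in
/-- The product of the generators along a word. -/
def word (l : List (Fin n)) : HypAlg w q := (l.map (gen w q)).prod

@[simp] lemma word_nil : word w q [] = 1 := rfl
@[simp] lemma word_cons (i : Fin n) (l : List (Fin n)) :
    word w q (i :: l) = gen w q i * word w q l := by simp [word]
@[simp] lemma word_append (l l' : List (Fin n)) :
    word w q (l ++ l') = word w q l * word w q l' := by simp [word]

lemma hypGrading_eq (m : ℕ) :
    hypGrading w q m = Submodule.span k {y | ∃ l, wt w l = m ∧ y = word w q l} := rfl

lemma word_mem (l : List (Fin n)) : word w q l ∈ hypGrading w q (wt w l) :=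
  Submodule.subset_span ⟨l, rfl, rfl⟩

lemma gen_mem (i : Fin n) : gen w q i ∈ hypGrading w q (w i) :=
  Submodule.subset_span ⟨[i], by simp, by simp⟩

lemma one_mem_hypGrading : (1 : HypAlg w q) ∈ hypGrading w q 0 :=
  Submodule.subset_span ⟨[], by simp, by simp⟩

lemma mul_mem_hypGrading {i j : ℕ} {r s : HypAlg w q} (hr : r ∈ hypGrading w q i)
    (hs : s ∈ hypGrading w q j) : r * s ∈ hypGrading w q (i + j) := by
  rw [hypGrading_eq] at hr hs
  induction hr using Submodule.span_induction with
  | mem x hx =>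
    obtain ⟨l, rfl, rfl⟩ := hx
    induction hs using Submodule.span_induction with
    | mem y hy =>
      obtain ⟨l', rfl, rfl⟩ := hy
      rw [← word_append, ← wt_append]
      exact word_mem _
    | zero => simp
    | add x y _ _ hx hy => rw [mul_add]; exact add_mem hx hy
    | smul c x _ hx => rw [mul_smul_comm]; exact Submodule.smul_mem _ _ hx
  | zero => simp
  | add x y _ _ hx hy => rw [add_mul]; exact add_mem hx hy
  | smul c x _ hx => rw [smul_mul_assoc]; exact Submodule.smul_mem _ _ hx

lemma pow_mem_hypGrading {i : ℕ} {r : HypAlg w q} (hr : r ∈ hypGrading w q i) (e : ℕ) :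
    r ^ e ∈ hypGrading w q (e * i) := by
  induction e with
  | zero => simpa using one_mem_hypGrading
  | succ e ih => rw [pow_succ, add_mul, one_mul]; exact mul_mem_hypGrading ih hr

lemma span_words : Submodule.span k (Set.range (word w q)) = ⊤ := by
  have hmul : ∀ x ∈ Submodule.span k (Set.range (word w q)),
      ∀ y ∈ Submodule.span k (Set.range (word w q)),
      x * y ∈ Submodule.span k (Set.range (word w q)) := by
    intro x hx y hy
    have := Submodule.mul_mem_mul hx hy
    rw [Submodule.span_mul_span] at this
    refine Submodule.span_mono ?_ this
    rintro _ ⟨_, ⟨l, rfl⟩, _, ⟨l', rfl⟩, rfl⟩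
    exact ⟨l ++ l', by simp⟩
  rw [eq_top_iff]
  rintro y -
  obtain ⟨x, rfl⟩ := RingQuot.mkAlgHom_surjective k (Rel w q) y
  induction x using FreeAlgebra.induction with
  | grade0 r =>
    rw [AlgHom.commutes, Algebra.algebraMap_eq_smul_one]
    exact Submodule.smul_mem _ _ (Submodule.subset_span ⟨[], rfl⟩)
  | grade1 i => exact Submodule.subset_span ⟨[i], by simp [gen]⟩
  | mul a b ha hb => rw [map_mul]; exact hmul _ ha _ hb
  | add a b ha hb => rw [map_add]; exact add_mem ha hb

lemma induction_words {motive : HypAlg w q → Prop} (word : ∀ l, motive (word w q l))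
    (zero : motive 0) (add : ∀ x y, motive x → motive y → motive (x + y))
    (smul : ∀ (c : k) x, motive x → motive (c • x)) (r : HypAlg w q) : motive r := by
  have hr : r ∈ Submodule.span k (Set.range (QuantumWeighted.word w q)) := by
    rw [span_words]; trivial
  induction hr using Submodule.span_induction with
  | mem x hx => obtain ⟨l, rfl⟩ := hx; exact word l
  | zero => exact zero
  | add x y _ _ hx hy => exact add _ _ hx hy
  | smul c x _ hx => exact smul _ _ hx

lemma gen_mul_gen (i j : Fin n) :
    gen w q j * gen w q i = q j i • (gen w q i * gen w q j) := by
  have := RingQuot.mkAlgHom_rel k (Rel.comm (w := w) (q := q) i j)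
  simpa [gen] using this

lemma sum_gen_pow : ∑ i, gen w q i ^ expo w i = 0 := by
  have := RingQuot.mkAlgHom_rel k (Rel.hyp (w := w) (q := q))
  simpa [gen] using this

/-- Normality of the generators: it makes kernels of the x_i on right modules stable under the whole
algebra. -/
lemma word_mul_gen (hq : ∀ i j, q i j ≠ 0) (i : Fin n) (l : List (Fin n)) :
    ∃ c : k, c ≠ 0 ∧ word w q l * gen w q i = c • (gen w q i * word w q l) := by
  induction l with
  | nil => exact ⟨1, one_ne_zero, by simp⟩
  | cons j l ih =>
    obtain ⟨c, hc, h⟩ := ih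
    refine ⟨c * q j i, mul_ne_zero hc (hq _ _), ?_⟩
    rw [word_cons, mul_assoc, h, mul_smul_comm, ← mul_assoc, gen_mul_gen i j]
    simp [mul_smul, mul_assoc]

lemma wt_ge_length (hw : ∀ i, 0 < w i) (l : List (Fin n)) : l.length ≤ wt w l := by
  induction l with
  | nil => simp
  | cons i l ih => have := hw i; simp; omega

lemma finite_wt (hw : ∀ i, 0 < w i) (m : ℕ) : {l : List (Fin n) | wt w l = m}.Finite :=
  (List.finite_length_le (Fin n) m).subset fun l (hl : wt w l = m) =>
    hl ▸ wt_ge_length hw l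

/-- Every word of large weight starts with a word whose weight lies in a given window. -/
lemma exists_initial_word (B : ℕ) (hB : ∀ i, w i ≤ B) (s : ℕ) (l : List (Fin n))
    (hl : s ≤ wt w l) :
    ∃ l₁ l₂, l = l₁ ++ l₂ ∧ s ≤ wt w l₁ ∧ wt w l₁ ≤ s + B := by
  induction l generalizing s with
  | nil => exact ⟨[], [], rfl, hl, by simp⟩
  | cons i l ih =>
    by_cases h : s ≤ w i
    · exact ⟨[i], l, rfl, by simpa using h, by simpa using (hB i).trans (by omega)⟩
    · simp only [wt_cons] at hl
      obtain ⟨l₁, l₂, rfl, h1, h2⟩ := ih (s - w i) (by omega)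
      exact ⟨i :: l₁, l₂, rfl, by simp; omega, by simp; omega⟩

end Algebra

/-! ### Growth of graded modules -/

section Growth

variable {k : Type u} [Field k] {n : ℕ} {w : Fin n → ℕ} {q : Fin n → Fin n → k}

lemma GrMod.word_smul_mem (M : GrMod k (hypGrading w q)) {i : ℤ} {m : M.carrier}
    (hm : m ∈ M.deg i) (l : List (Fin n)) : op (word w q l) • m ∈ M.deg (i + wt w l) :=
  M.smul_mem i _ m _ hm (word_mem l)

lemma GrMod.deg_eq_span (M : GrMod k (hypGrading w q)) (G : Finset (ℤ × M.carrier))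
    (hG : ∀ p ∈ G, p.2 ∈ M.deg p.1)
    (hspan : Submodule.span (HypAlg w q)ᵐᵒᵖ (Prod.snd '' (G : Set (ℤ × M.carrier))) = ⊤) (i : ℤ) :
    Submodule.span k {y | ∃ p ∈ G, ∃ l, p.1 + (wt w l : ℤ) = i ∧ y = op (word w q l) • p.2} =
      M.deg i := by
  refine M.deg_eq_of_le (fun i => Submodule.span k {y | ∃ p ∈ G, ∃ l, p.1 + (wt w l : ℤ) = i ∧
    y = op (word w q l) • p.2}) ?_ ?_ i
  · intro i
    rw [Submodule.span_le]
    rintro _ ⟨p, hp, l, rfl, rfl⟩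
    exact M.word_smul_mem (hG p hp) l
  · rw [eq_top_iff]
    rintro m -
    have hm : m ∈ Submodule.span (HypAlg w q)ᵐᵒᵖ (Prod.snd '' (G : Set (ℤ × M.carrier))) := by
      rw [hspan]; trivial
    rw [← Submodule.span_iUnion]
    set U := Submodule.span k (⋃ i, {y | ∃ p ∈ G, ∃ l, p.1 + (wt w l : ℤ) = i ∧
      y = op (word w q l) • p.2}) with hU
    have hstable : ∀ r : HypAlg w q, ∀ y ∈ U, op r • y ∈ U := by
      intro r y hy
      induction r using induction_words with
      | word l =>
        rw [hU] at hy
        induction hy using Submodule.span_induction with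
        | mem x hx =>
          obtain ⟨i, p, hp, l', rfl, rfl⟩ := Set.mem_iUnion.1 hx
          refine Submodule.subset_span (Set.mem_iUnion.2 ⟨_, p, hp, l' ++ l, rfl, ?_⟩)
          rw [word_append, op_mul, mul_smul]
        | zero => simp
        | add x y _ _ hx hy => rw [smul_add]; exact add_mem hx hy
        | smul c x _ hx => rw [smul_comm]; exact Submodule.smul_mem _ _ hx
      | zero => simp
      | add x y hx hy => rw [MulOpposite.op_add, add_smul]; exact add_mem hx hy
      | smul c x hx => rw [op_smul, smul_assoc]; exact Submodule.smul_mem _ _ hx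
    induction hm using Submodule.span_induction with
    | mem x hx =>
      obtain ⟨p, hp, rfl⟩ := hx
      exact Submodule.subset_span (Set.mem_iUnion.2 ⟨_, p, hp, [], rfl, by simp⟩)
    | zero => simp
    | add x y _ _ hx hy => exact add_mem hx hy
    | smul c x _ hx => exact hstable c.unop _ hx

lemma GrMod.finite_deg (hw : ∀ i, 0 < w i) (M : GrMod k (hypGrading w q)) (i : ℤ) :
    FiniteDimensional k (M.deg i) := by
  obtain ⟨G, hG, hspan⟩ := M.exists_homogeneous_generators
  rw [← M.deg_eq_span G hG hspan i]
  refine FiniteDimensional.span_of_finite k ?_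
  have : {y | ∃ p ∈ G, ∃ l, p.1 + (wt w l : ℤ) = i ∧ y = op (word w q l) • p.2} ⊆
      ⋃ p ∈ G, (fun l => op (word w q l) • p.2) '' {l | wt w l = (i - p.1).toNat} := by
    rintro _ ⟨p, hp, l, hl, rfl⟩
    simp only [Set.mem_iUnion]
    refine ⟨p, hp, l, ?_, rfl⟩
    change wt w l = _; omega
  exact (G.finite_toSet.biUnion fun p _ => (finite_wt hw _).image _).subset this

lemma GrMod.exists_lower_bound (M : GrMod k (hypGrading w q)) :
    ∃ N : ℤ, ∀ i < N, M.deg i = ⊥ := by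
  obtain ⟨G, hG, hspan⟩ := M.exists_homogeneous_generators
  obtain ⟨N, hN⟩ := (G.finite_toSet.image Prod.fst).bddBelow
  refine ⟨N, fun i hi => ?_⟩
  rw [← M.deg_eq_span G hG hspan i, Submodule.span_eq_bot]
  rintro _ ⟨p, hp, l, hl, rfl⟩
  have := hN ⟨p, hp, rfl⟩
  omega

/-- If a window of components above all generators vanishes, then so do all later components. -/
lemma GrMod.exists_window (B : ℕ) (hB : ∀ i, w i ≤ B) (hw : ∀ i, 0 < w i)
    (M : GrMod k (hypGrading w q)) :
    ∃ N : ℤ, ∀ i ≥ N, (∀ j, i ≤ j → j < i + B → M.deg j = ⊥) → ∀ j ≥ i, M.deg j = ⊥ := by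
  obtain ⟨G, hG, hspan⟩ := M.exists_homogeneous_generators
  obtain ⟨N, hN⟩ := (G.finite_toSet.image Prod.fst).bddAbove
  refine ⟨N + 1, fun i hi h j hj => ?_⟩
  obtain ⟨t, rfl⟩ : ∃ t : ℕ, j = i + t := ⟨(j - i).toNat, by omega⟩
  induction t using Nat.strong_induction_on with
  | _ t ih =>
    by_cases ht : t < B
    · exact h _ (by omega) (by omega)
    rw [← M.deg_eq_span G hG hspan, Submodule.span_eq_bot]
    rintro _ ⟨p, hp, l, hl, rfl⟩
    have hpN := hN ⟨p, hp, rfl⟩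
    -- The empty word is excluded because the degree exceeds those of all generators. Otherwise
    -- dropping the last letter lowers the degree by between 1 and `B`, into a component already
    -- known to vanish.
    rcases List.eq_nil_or_concat l with rfl | ⟨l', a, rfl⟩
    · simp only [wt_nil] at hl; omega
    · simp only [List.concat_eq_append, wt_append, wt_cons, wt_nil] at hl ⊢
      have h1 := hB a
      have h2 := hw a
      have h3 := ih (t - w a) (by omega) (by omega)
      have h4 := M.word_smul_mem (hG p hp) l'
      have h5 : p.1 + (wt w l' : ℤ) = i + ((t - w a : ℕ) : ℤ) := by omega
      rw [h5, h3, Submodule.mem_bot] at h4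
      rw [word_append, op_mul, mul_smul, h4, smul_zero]

lemma tendsto_log_mul_div_log {c : ℝ} (hc : 0 < c) :
    Tendsto (fun m : ℕ => Real.log (c * m) / Real.log m) atTop (𝓝 1) := by
  have h1 : Tendsto (fun m : ℕ => Real.log (m : ℝ)) atTop atTop :=
    Real.tendsto_log_atTop.comp tendsto_natCast_atTop_atTop
  have h2 : Tendsto (fun m : ℕ => Real.log c / Real.log m + 1) atTop (𝓝 (0 + 1)) :=
    (h1.const_div_atTop _).add_const 1
  rw [zero_add] at h2
  refine h2.congr' ?_
  filter_upwards [eventually_ge_atTop 2] with m hm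
  have hm' : (2 : ℝ) ≤ m := by exact_mod_cast hm
  have : Real.log m ≠ 0 := (Real.log_pos (by linarith)).ne'
  rw [Real.log_mul hc.ne' (by positivity)]
  field_simp

/-- One nonzero component in every window of length `B` makes the partial sums of the Hilbert
function grow at least linearly. -/
lemma GrMod.one_le_gkdim (M : GrMod k (hypGrading w q)) (hw : ∀ i, 0 < w i) (B : ℕ) (hB : 0 < B)
    (N : ℤ) (h : ∀ i ≥ N, ∃ j, i ≤ j ∧ j < i + B ∧ M.deg j ≠ ⊥) : 1 ≤ M.gkdim := by
  have hN : ∃ N : ℕ, ∀ i : ℤ, N ≤ i → ∃ j, i ≤ j ∧ j < i + B ∧ 1 ≤ M.hilb j := by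
    refine ⟨N.toNat, fun i hi => ?_⟩
    obtain ⟨j, h1, h2, h3⟩ := h i (by omega)
    refine ⟨j, h1, h2, ?_⟩
    have := M.finite_deg hw j
    exact Submodule.one_le_finrank_iff.2 h3
  obtain ⟨N, hN⟩ := hN
  choose! f hf1 hf2 hf3 using hN
  have hS : ∀ m : ℕ, 2 * (N + B) ≤ m →
      (1 / (2 * B) : ℝ) * m ≤ ∑ i ∈ Finset.Icc (-(m : ℤ)) m, (M.hilb i : ℝ) := by
    intro m hm
    set T := (m - N) / B with hT
    have hTB : T * B ≤ m - N := Nat.div_mul_le_self _ _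
    have hTB' : m - N < T * B + B := Nat.lt_div_mul_add hB
    -- One nonzero degree is taken from each of the `T` disjoint windows that fit between `N` and
    -- `m`. Since `m ≥ 2(N + B)`, these windows cover at least half of `m`, whence the constant
    -- 1/(2B).
    let φ : ℕ → ℤ := fun t => f (N + t * B)
    have hφN : ∀ t : ℕ, (N : ℤ) ≤ N + t * B := fun t => by
      have : (0 : ℤ) ≤ t * B := by positivity
      omega
    have hφ : ∀ t : ℕ, (N : ℤ) + t * B ≤ φ t ∧ φ t < N + t * B + B := fun t =>
      ⟨hf1 _ (hφN t), hf2 _ (hφN t)⟩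
    have hmono : StrictMono φ := strictMono_nat_of_lt_succ fun t => by
      have h1 := (hφ t).2
      have h2 := (hφ (t + 1)).1
      push_cast at h2
      linarith
    have hsub : (Finset.range T).image φ ⊆ Finset.Icc (-(m : ℤ)) m := by
      intro x hx
      obtain ⟨t, ht, rfl⟩ := Finset.mem_image.1 hx
      have h1 := hφ t
      have h2 : (t + 1) * B ≤ T * B := Nat.mul_le_mul_right _ (Finset.mem_range.1 ht)
      have h3 : (t : ℤ) * B + B ≤ m - N := by
        have : (t + 1) * B + N ≤ m := by omega
        have : ((t : ℤ) + 1) * B + N ≤ m := by exact_mod_cast this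
        linarith
      have h4 := hφN t
      rw [Finset.mem_Icc]
      omega
    have hcard : ((Finset.range T).image φ).card = T := by
      rw [Finset.card_image_of_injective _ hmono.injective, Finset.card_range]
    calc (1 / (2 * B) : ℝ) * m ≤ T := by
          have hB' : (0 : ℝ) < B := by exact_mod_cast hB
          have : m ≤ 2 * (T * B) := by omega
          have : (m : ℝ) ≤ 2 * (T * B) := by exact_mod_cast this
          rw [div_mul_eq_mul_div, div_le_iff₀ (by positivity)]
          linarith
      _ = ∑ i ∈ (Finset.range T).image φ, (1 : ℝ) := by simp [hcard]
      _ ≤ ∑ i ∈ (Finset.range T).image φ, (M.hilb i : ℝ) := by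
          refine Finset.sum_le_sum fun i hi => ?_
          obtain ⟨t, -, rfl⟩ := Finset.mem_image.1 hi
          exact_mod_cast hf3 _ (hφN t)
      _ ≤ _ := Finset.sum_le_sum_of_subset_of_nonneg hsub fun _ _ _ => Nat.cast_nonneg _
  have hc : (0 : ℝ) < 1 / (2 * B) := by positivity
  have hlim := (continuous_coe_real_ereal.tendsto 1).comp (tendsto_log_mul_div_log hc)
  have := hlim.limsup_eq
  rw [EReal.coe_one] at this
  rw [← this]
  refine limsup_le_limsup ?_
  filter_upwards [eventually_ge_atTop (2 * (N + B)), eventually_ge_atTop 2] with m hm hm2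
  have hm' : (2 : ℝ) ≤ m := by exact_mod_cast hm2
  have hlog : 0 < Real.log m := Real.log_pos (by linarith)
  simp only [Function.comp_apply, EReal.coe_le_coe_iff]
  gcongr
  exact hS m hm

lemma GrMod.gkdim_le_of_eventually_le (M : GrMod k (hypGrading w q)) (u : ℕ → ℝ) (e : ℝ)
    (hu : ∀ᶠ m in atTop, 1 ≤ u m)
    (hlim : Tendsto (fun m : ℕ => Real.log (u m) / Real.log m) atTop (𝓝 e))
    (h : ∀ᶠ m : ℕ in atTop, ∑ i ∈ Finset.Icc (-(m : ℤ)) m, (M.hilb i : ℝ) ≤ u m) :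
    M.gkdim ≤ e := by
  have hlim' := (continuous_coe_real_ereal.tendsto e).comp hlim
  rw [← hlim'.limsup_eq]
  refine limsup_le_limsup ?_
  filter_upwards [h, hu, eventually_ge_atTop 2] with m hm hum hm2
  have hm' : (2 : ℝ) ≤ m := by exact_mod_cast hm2
  have hlog : 0 < Real.log m := Real.log_pos (by linarith)
  simp only [Function.comp_apply, EReal.coe_le_coe_iff]
  refine div_le_div_of_nonneg_right ?_ hlog.le
  -- A vanishing partial sum has `Real.log 0 = 0`, so monotonicity of the logarithm fails there;
  -- this is what the assumption `1 ≤ u m` is for.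
  rcases eq_or_ne (∑ i ∈ Finset.Icc (-(m : ℤ)) m, (M.hilb i : ℝ)) 0 with h0 | h0
  · rw [h0, Real.log_zero]; exact Real.log_nonneg hum
  · exact Real.log_le_log
      (lt_of_le_of_ne (Finset.sum_nonneg fun _ _ => Nat.cast_nonneg _) h0.symm) hm

lemma GrMod.gkdim_le_one (M : GrMod k (hypGrading w q)) (h : ∀ i, M.hilb i ≤ 1) :
    M.gkdim ≤ 1 := by
  refine M.gkdim_le_of_eventually_le (fun m => 3 * m) 1 ?_
    (tendsto_log_mul_div_log (by norm_num)) ?_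
  · filter_upwards [eventually_ge_atTop 1] with m hm
    have : (1 : ℝ) ≤ m := by exact_mod_cast hm
    linarith
  · filter_upwards [eventually_ge_atTop 1] with m hm
    have h1 : (1 : ℝ) ≤ m := by exact_mod_cast hm
    calc ∑ i ∈ Finset.Icc (-(m : ℤ)) m, (M.hilb i : ℝ)
        ≤ ∑ i ∈ Finset.Icc (-(m : ℤ)) m, (1 : ℝ) :=
          Finset.sum_le_sum fun i _ => by exact_mod_cast h i
      _ = ((Finset.Icc (-(m : ℤ)) m).card : ℝ) := by simp
      _ ≤ 3 * m := by
        rw [Int.card_Icc]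
        have : ((m : ℤ) + 1 - -(m : ℤ)).toNat = 2 * m + 1 := by omega
        rw [this]; push_cast; linarith

lemma GrMod.gkdim_lt_one_of_eventually_zero (M : GrMod k (hypGrading w q)) (N : ℤ)
    (h : ∀ i ≥ N, M.deg i = ⊥) : M.gkdim < 1 := by
  obtain ⟨N', hN'⟩ := M.exists_lower_bound
  have h0 : ∀ i, i ∉ Finset.Icc N' N → M.hilb i = 0 := by
    intro i hi
    rw [Finset.mem_Icc, not_and_or] at hi
    have : M.deg i = ⊥ := by
      rcases hi with hi | hi
      · exact hN' i (by omega)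
      · exact h i (by omega)
    rw [GrMod.hilb, this]; simp
  -- The majorant is constant, so its logarithm over `log m` tends to 0; the summand 1 keeps it at
  -- least 1 even for the zero module.
  refine (M.gkdim_le_of_eventually_le (fun _ => 1 + ∑ i ∈ Finset.Icc N' N, (M.hilb i : ℝ)) 0
    ?_ ?_ ?_).trans_lt (by exact_mod_cast zero_lt_one)
  · exact Eventually.of_forall fun _ =>
      le_add_of_nonneg_right (Finset.sum_nonneg fun _ _ => Nat.cast_nonneg _)
  · exact (Real.tendsto_log_atTop.comp tendsto_natCast_atTop_atTop).const_div_atTop _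
  · refine Eventually.of_forall fun m => ?_
    have : ∑ i ∈ Finset.Icc (-(m : ℤ)) m, (M.hilb i : ℝ) ≤
        ∑ i ∈ Finset.Icc N' N, (M.hilb i : ℝ) := by
      rw [← Finset.sum_filter_add_sum_filter_not _ (fun i => i ∈ Finset.Icc N' N)]
      rw [Finset.sum_eq_zero (s := Finset.filter (fun i => i ∉ Finset.Icc N' N) _), add_zero]
      · exact Finset.sum_le_sum_of_subset_of_nonneg (fun i hi => (Finset.mem_filter.1 hi).2)
          fun _ _ _ => Nat.cast_nonneg _
      · intro i hi
        rw [h0 i (Finset.mem_filter.1 hi).2, Nat.cast_zero]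
    linarith

lemma exists_weight_bound (w : Fin n → ℕ) : ∃ B : ℕ, 0 < B ∧ ∀ i, w i ≤ B :=
  ⟨∑ i, w i + 1, by omega, fun i => by
    have := Finset.single_le_sum (f := w) (fun _ _ => Nat.zero_le _) (Finset.mem_univ i)
    omega⟩

/-- By `GrMod.exists_window`, a module not eventually zero has a nonzero component in every late
window, hence dimension at least 1. There is thus no growth strictly between finite-dimensional and
linear. -/
lemma GrMod.eventually_zero_of_gkdim_lt_one (hw : ∀ i, 0 < w i) (M : GrMod k (hypGrading w q))
    (h : M.gkdim < 1) : ∃ N : ℤ, ∀ i ≥ N, M.deg i = ⊥ := by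
  obtain ⟨B, hB0, hB⟩ := exists_weight_bound w
  obtain ⟨N, hN⟩ := M.exists_window B hB hw
  by_contra! hne
  refine absurd h (not_lt.2 (M.one_le_gkdim hw B hB0 N fun i hi => ?_))
  by_contra! hcon
  obtain ⟨j, hj, hj'⟩ := hne i
  exact hj' (hN i hi hcon j hj)

/-- In a `1`-critical module, a nonzero homogeneous element generates all components of large
degree. -/
lemma GrMod.IsOneCritical.eventually_le_span (hw : ∀ i, 0 < w i) {M : GrMod k (hypGrading w q)}
    (hM : M.IsOneCritical) {i : ℤ} {m : M.carrier} (hm : m ∈ M.deg i) (hm0 : m ≠ 0) :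
    ∃ N : ℤ, ∀ j ≥ N, ∀ x ∈ M.deg j,
      x ∈ Submodule.span k {y | ∃ l, i + (wt w l : ℤ) = j ∧ y = op (word w q l) • m} := by
  set U : ℤ → Submodule k M.carrier :=
    fun j => Submodule.span k {y | ∃ l, i + (wt w l : ℤ) = j ∧ y = op (word w q l) • m} with hU
  have hUdeg : ∀ j, U j ≤ M.deg j := by
    intro j
    rw [hU, Submodule.span_le]
    rintro _ ⟨l, rfl, rfl⟩
    exact M.word_smul_mem hm l
  set K := Submodule.span (HypAlg w q)ᵐᵒᵖ {m} with hKdef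
  have hpr : ∀ j, ∀ x ∈ K, M.pr j x ∈ U j := by
    intro j x hx
    obtain ⟨r, rfl⟩ := Submodule.mem_span_singleton.1 hx
    obtain ⟨r, rfl⟩ := op_surjective r
    clear hx
    induction r using induction_words with
    | word l =>
      rw [M.pr_apply_of_mem (M.word_smul_mem hm l)]
      split_ifs with h
      · exact Submodule.subset_span ⟨l, h, rfl⟩
      · exact zero_mem _
    | zero => simp
    | add x y hx hy =>
      rw [MulOpposite.op_add, add_smul, map_add]
      exact add_mem hx hy
    | smul c x hx =>
      rw [op_smul, smul_assoc, map_smul]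
      exact Submodule.smul_mem _ _ hx
  have hUK : ∀ j, ∀ x ∈ U j, x ∈ K := by
    intro j x hx
    have : U j ≤ K.restrictScalars k := by
      rw [hU, Submodule.span_le]
      rintro _ ⟨l, -, rfl⟩
      exact Submodule.smul_mem _ _ (Submodule.mem_span_singleton_self m)
    exact this hx
  have hK : ∀ j, ∀ x ∈ K, M.pr j x ∈ K := fun j x hx => hUK j _ (hpr j x hx)
  -- Criticality makes the quotient by the cyclic submodule of `m` have dimension less than 1, so it
  -- vanishes in large degrees and the submodule is everything there.
  have hlt := hM.2 (M.quot K hK) (M.quotMk K hK) K.mkQ_surjective (by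
    intro hinj
    have h1 : K.mkQ m = K.mkQ 0 := by
      rw [map_zero, Submodule.mkQ_apply, Submodule.Quotient.mk_eq_zero]
      exact Submodule.mem_span_singleton_self m
    exact hm0 (hinj h1))
  obtain ⟨N, hN⟩ := (M.quot K hK).eventually_zero_of_gkdim_lt_one hw hlt
  refine ⟨N, fun j hj x hx => ?_⟩
  have h1 : (K.mkQ x) ∈ (M.quot K hK).deg j := ⟨x, hx, rfl⟩
  rw [hN j hj] at h1
  have h2 : K.mkQ x = 0 := (Submodule.mem_bot k).1 h1
  rw [Submodule.mkQ_apply, Submodule.Quotient.mk_eq_zero] at h2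
  rw [← M.pr_of_mem hx]
  exact hpr j x h2

lemma GrMod.IsOneCritical.exists_ne_bot {M : GrMod k (hypGrading w q)}
    (hM : M.IsOneCritical) (N : ℤ) : ∃ i ≥ N, M.deg i ≠ ⊥ := by
  by_contra! h
  exact absurd hM.1 (M.gkdim_lt_one_of_eventually_zero N h).ne

/-- A homogeneous element of a `1`-critical module that is annihilated by all long words is zero. -/
lemma GrMod.IsOneCritical.eq_zero_of_torsion (hw : ∀ i, 0 < w i) {M : GrMod k (hypGrading w q)}
    (hM : M.IsOneCritical) {i : ℤ} {m : M.carrier} (hm : m ∈ M.deg i) (s : ℕ)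
    (h : ∀ l, s ≤ wt w l → op (word w q l) • m = 0) : m = 0 := by
  by_contra hm0
  obtain ⟨N, hN⟩ := hM.eventually_le_span hw hm hm0
  obtain ⟨j, hj, hne⟩ := hM.exists_ne_bot (max N (i + s))
  refine hne ((Submodule.eq_bot_iff _).2 fun x hx => ?_)
  have h1 := hN j (le_of_max_le_left hj) x hx
  have h2 := le_of_max_le_right hj
  have h3 : Submodule.span k {y | ∃ l, i + (wt w l : ℤ) = j ∧ y = op (word w q l) • m} = ⊥ := by
    rw [Submodule.span_eq_bot]
    rintro _ ⟨l, hl, rfl⟩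
    exact h l (by omega)
  rwa [h3] at h1

end Growth

/-! ### Invariants of isomorphism classes in `qgr` -/

section Invariant

variable {k : Type u} [Field k] {n : ℕ} {w : Fin n → ℕ} {q : Fin n → Fin n → k}

/-- An element of a graded module is torsion if it is annihilated by all words of large weight. -/
def GrMod.IsTors (M : GrMod k (hypGrading w q)) (m : M.carrier) : Prop :=
  ∃ s : ℕ, ∀ l, s ≤ wt w l → op (word w q l) • m = 0

lemma GrMod.IsTors.zero (M : GrMod k (hypGrading w q)) : M.IsTors 0 := ⟨0, by simp⟩

lemma GrMod.IsTors.add {M : GrMod k (hypGrading w q)} {x y : M.carrier} (hx : M.IsTors x)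
    (hy : M.IsTors y) : M.IsTors (x + y) := by
  obtain ⟨s, hs⟩ := hx
  obtain ⟨t, ht⟩ := hy
  refine ⟨max s t, fun l hl => ?_⟩
  rw [smul_add, hs l (le_of_max_le_left hl), ht l (le_of_max_le_right hl), add_zero]

lemma GrMod.IsTors.neg {M : GrMod k (hypGrading w q)} {x : M.carrier} (hx : M.IsTors x) :
    M.IsTors (-x) := by
  obtain ⟨s, hs⟩ := hx
  exact ⟨s, fun l hl => by rw [smul_neg, hs l hl, neg_zero]⟩

lemma GrMod.IsTors.map {M N : GrMod k (hypGrading w q)} (f : M ⟶ N) {x : M.carrier}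
    (hx : M.IsTors x) : N.IsTors (GrMod.Hom.toLin f x) := by
  obtain ⟨s, hs⟩ := hx
  exact ⟨s, fun l hl => by rw [← map_smul, hs l hl, map_zero]⟩

/-- Each kernel element has its own torsion bound. To make it uniform, a long word is split after an
initial piece whose weight lies in a fixed window; there are only finitely many such pieces, so
their bounds have a maximum. -/
lemma GrMod.IsTors.of_map (hw : ∀ i, 0 < w i) {M N : GrMod k (hypGrading w q)} (f : M ⟶ N)
    (hf : torsionIso k (hypGrading w q) f) {x : M.carrier}
    (hx : N.IsTors (GrMod.Hom.toLin f x)) : M.IsTors x := by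
  obtain ⟨B, -, hB⟩ := exists_weight_bound w
  obtain ⟨s, hs⟩ := hx
  have h1 : ∀ l, s ≤ wt w l → ∃ t : ℕ, ∀ l', t ≤ wt w l' →
      op (word w q l') • op (word w q l) • x = 0 := by
    intro l hl
    obtain ⟨t, ht⟩ := hf.1 (op (word w q l) • x) (by rw [map_smul, hs l hl])
    exact ⟨t, fun l' hl' => ht _ hl' _ (word_mem l')⟩
  choose! t ht using h1
  have hfin : {l : List (Fin n) | wt w l ≤ s + B}.Finite :=
    (List.finite_length_le (Fin n) (s + B)).subset fun l (hl : wt w l ≤ s + B) =>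
      (wt_ge_length hw l).trans hl
  obtain ⟨T, hT⟩ := (hfin.image t).bddAbove
  refine ⟨s + B + T, fun l hl => ?_⟩
  obtain ⟨l₁, l₂, rfl, h1, h2⟩ := exists_initial_word B hB s l (by omega)
  have h3 : t l₁ ≤ T := hT ⟨l₁, h2, rfl⟩
  rw [wt_append] at hl
  rw [word_append, op_mul, mul_smul]
  exact ht l₁ h1 l₂ (by omega)

/-- Finite generation again makes the bound uniform: the cokernel is torsion on each of finitely
many homogeneous generators. -/
lemma torsionIso.eventually_surjective {M N : GrMod k (hypGrading w q)}
    (f : M ⟶ N) (hf : torsionIso k (hypGrading w q) f) :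
    ∃ N₀ : ℤ, ∀ i ≥ N₀, ∀ y ∈ N.deg i, ∃ x ∈ M.deg i, GrMod.Hom.toLin f x = y := by
  obtain ⟨G, hG, hspan⟩ := N.exists_homogeneous_generators
  choose s hs using hf.2
  obtain ⟨N₀, hN₀⟩ := (G.finite_toSet.image fun p => p.1 + (s p.2 : ℤ)).bddAbove
  refine ⟨N₀, fun i hi y hy => ?_⟩
  have h1 : y ∈ LinearMap.range (GrMod.Hom.toLin f) := by
    have h2 : N.deg i ≤ (LinearMap.range (GrMod.Hom.toLin f)).restrictScalars k := by
      rw [← N.deg_eq_span G hG hspan, Submodule.span_le]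
      rintro _ ⟨p, hp, l, hl, rfl⟩
      have : p.1 + (s p.2 : ℤ) ≤ N₀ := hN₀ ⟨p, hp, rfl⟩
      exact hs p.2 (wt w l) (by omega) _ (word_mem l)
    exact h2 hy
  obtain ⟨x, rfl⟩ := h1
  exact ⟨M.pr i x, M.pr_mem i x, by rw [GrMod.Hom.toLin_pr, N.pr_of_mem hy]⟩

/-- Sequences of homogeneous elements of prescribed degrees, two of which are identified if their
difference eventually becomes torsion after multiplication by `z`. -/
def germSetoid (δ : ℕ → ℤ) (z : HypAlg w q) (M : GrMod k (hypGrading w q)) :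
    Setoid {m : ℕ → M.carrier // ∀ t, m t ∈ M.deg (δ t)} where
  r m m' := ∀ᶠ t in atTop, M.IsTors (op z • (m.1 t - m'.1 t))
  iseqv := by
    refine ⟨fun m => Eventually.of_forall fun t => ?_, fun {m m'} h => ?_, fun {a b c} h h' => ?_⟩
    · rw [sub_self, smul_zero]; exact GrMod.IsTors.zero M
    · filter_upwards [h] with t ht
      rw [← neg_sub, smul_neg]
      exact ht.neg
    · filter_upwards [h, h'] with t ht ht'
      rw [← sub_add_sub_cancel _ (b.1 t), smul_add]
      exact ht.add ht'

/-- The functor sending a graded module to its set of germs. -/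
def germFunctor (w : Fin n → ℕ) (q : Fin n → Fin n → k) (δ : ℕ → ℤ) (z : HypAlg w q) :
    GrMod k (hypGrading w q) ⥤ Type u where
  obj M := Quotient (germSetoid δ z M)
  map {M N} f := ↾(Quotient.map (fun m => ⟨fun t => GrMod.Hom.toLin f (m.1 t),
      fun t => GrMod.Hom.map_deg f _ _ (m.2 t)⟩) (by
        intro m m' h
        filter_upwards [show ∀ᶠ t in atTop, M.IsTors (op z • (m.1 t - m'.1 t)) from h] with t ht
        rw [← map_sub, ← map_smul]
        exact ht.map f))
  map_id M := by
    ext x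
    induction x using Quotient.inductionOn
    rfl
  map_comp f g := by
    ext x
    induction x using Quotient.inductionOn
    rfl

/-- A torsion kernel gives injectivity because torsion is reflected by the map; surjectivity in
large degrees gives surjectivity on germs because `δ` tends to infinity. -/
lemma germFunctor_inverts (hw : ∀ i, 0 < w i) (δ : ℕ → ℤ) (hδ : Tendsto δ atTop atTop)
    (z : HypAlg w q) : (torsionIso k (hypGrading w q)).IsInvertedBy (germFunctor w q δ z) := by
  intro M N f hf
  rw [isIso_iff_bijective]
  constructor
  · intro x y
    induction x using Quotient.inductionOn with | _ m
    induction y using Quotient.inductionOn with | _ m'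
    intro h
    refine Quotient.sound ?_
    filter_upwards [show ∀ᶠ t in atTop, N.IsTors (op z • (GrMod.Hom.toLin f (m.1 t) -
      GrMod.Hom.toLin f (m'.1 t))) from Quotient.exact h] with t ht
    rw [← map_sub, ← map_smul] at ht
    exact ht.of_map hw f hf
  · intro y
    induction y using Quotient.inductionOn with | _ m'
    obtain ⟨N₀, hN₀⟩ := torsionIso.eventually_surjective f hf
    have : ∀ t, ∃ x ∈ M.deg (δ t), N₀ ≤ δ t → GrMod.Hom.toLin f x = m'.1 t := by
      intro t
      by_cases h : N₀ ≤ δ t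
      · obtain ⟨x, hx, hxy⟩ := hN₀ _ h _ (m'.2 t)
        exact ⟨x, hx, fun _ => hxy⟩
      · exact ⟨0, zero_mem _, fun h' => absurd h' h⟩
    choose m hm hm' using this
    refine ⟨Quotient.mk _ ⟨m, hm⟩, Quotient.sound ?_⟩
    filter_upwards [hδ.eventually_ge_atTop N₀] with t ht
    rw [hm' t ht, sub_self, smul_zero]
    exact GrMod.IsTors.zero N

/-- The universal property of the localization extends the germ functor to the quotient category, so
an isomorphism there induces a bijection of germs. -/
lemma subsingleton_germ_of_iso (hw : ∀ i, 0 < w i) (δ : ℕ → ℤ) (hδ : Tendsto δ atTop atTop)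
    (z : HypAlg w q) {M N : GrMod k (hypGrading w q)}
    (e : (proj k (hypGrading w q)).obj M ≅ (proj k (hypGrading w q)).obj N)
    (hM : Subsingleton ((germFunctor w q δ z).obj M)) :
    Subsingleton ((germFunctor w q δ z).obj N) := by
  let F := Localization.Construction.lift (germFunctor w q δ z) (germFunctor_inverts hw δ hδ z)
  have e' : (germFunctor w q δ z).obj M ≅ (germFunctor w q δ z).obj N := F.mapIso e
  exact e'.toEquiv.symm.subsingleton

/-- Being annihilated by `z` in all large degrees `δ t`, up to torsion, is an invariant of the
isomorphism class in `qgr`. -/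
lemma eventually_isTors_of_iso (hw : ∀ i, 0 < w i) (δ : ℕ → ℤ) (hδ : Tendsto δ atTop atTop)
    (z : HypAlg w q) {M N : GrMod k (hypGrading w q)}
    (e : (proj k (hypGrading w q)).obj M ≅ (proj k (hypGrading w q)).obj N)
    (hM : ∀ᶠ t in atTop, ∀ m ∈ M.deg (δ t), M.IsTors (op z • m)) :
    ∀ᶠ t in atTop, ∀ m ∈ N.deg (δ t), N.IsTors (op z • m) := by
  have h1 : Subsingleton ((germFunctor w q δ z).obj M) := by
    refine ⟨fun x y => ?_⟩
    induction x using Quotient.inductionOn with | _ m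
    induction y using Quotient.inductionOn with | _ m'
    refine Quotient.sound ?_
    filter_upwards [hM] with t ht
    exact ht _ (sub_mem (m.2 t) (m'.2 t))
  have h2 := subsingleton_germ_of_iso hw δ hδ z e h1
  -- In each degree an element is chosen that violates the claim if any does. These form one germ,
  -- and its equality with the zero germ settles all large `t` at once.
  have h3 : ∀ t, ∃ m ∈ N.deg (δ t),
      N.IsTors (op z • m) → ∀ m ∈ N.deg (δ t), N.IsTors (op z • m) := by
    intro t
    by_cases h : ∀ m ∈ N.deg (δ t), N.IsTors (op z • m)
    · exact ⟨0, zero_mem _, fun _ => h⟩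
    · push Not at h
      obtain ⟨m, hm, hm'⟩ := h
      exact ⟨m, hm, fun h => absurd h hm'⟩
  choose m hm hm' using h3
  have h4 := Quotient.exact (h2.elim (Quotient.mk (germSetoid δ z N) ⟨m, hm⟩)
    (Quotient.mk (germSetoid δ z N) ⟨fun _ => 0, fun _ => zero_mem _⟩))
  filter_upwards [show ∀ᶠ t in atTop, N.IsTors (op z • (m t - 0)) from h4] with t ht
  rw [sub_zero] at ht
  exact hm' t ht

lemma mk_eq_of_torsionIso {M N : GrMod k (hypGrading w q)} (f : M ⟶ N)
    (hf : torsionIso k (hypGrading w q) f) :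
    Quotient.mk (isIsomorphicSetoid (Qgr k (hypGrading w q))) ((proj k (hypGrading w q)).obj M) =
      Quotient.mk (isIsomorphicSetoid (Qgr k (hypGrading w q)))
        ((proj k (hypGrading w q)).obj N) :=
  Quotient.sound ⟨Localization.Construction.wIso f hf⟩

end Invariant

/-! ### Multiplicity and the action of the generators on a critical module -/

section Critical

variable {k : Type u} [Field k] {n : ℕ} {w : Fin n → ℕ} {q : Fin n → Fin n → k}

/-- Dimension 1 < 2 bounds the Hilbert function eventually by m^2, and it vanishes in very negative
degrees. -/
lemma GrMod.summable_hilb (M : GrMod k (hypGrading w q)) (h1 : M.gkdim = 1) {t : ℝ}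
    (ht0 : 0 < t) (ht1 : t < 1) : Summable fun i : ℤ => (M.hilb i : ℝ) * t ^ i := by
  have hlt : M.gkdim < ((2 : ℝ) : EReal) := by rw [h1]; exact_mod_cast one_lt_two
  have hev := eventually_lt_of_limsup_lt hlt
  have hle : ∀ᶠ m : ℕ in atTop, (M.hilb m : ℝ) ≤ (m : ℝ) ^ 2 := by
    filter_upwards [hev, eventually_ge_atTop 2] with m hm hm2
    have hm' : (2 : ℝ) ≤ m := by exact_mod_cast hm2
    have hlog : 0 < Real.log m := Real.log_pos (by linarith)
    rw [EReal.coe_lt_coe_iff, div_lt_iff₀ hlog] at hm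
    have hS : (M.hilb m : ℝ) ≤ ∑ i ∈ Finset.Icc (-(m : ℤ)) m, (M.hilb i : ℝ) :=
      Finset.single_le_sum (f := fun i : ℤ => (M.hilb i : ℝ)) (fun _ _ => Nat.cast_nonneg _)
        (Finset.mem_Icc.2 ⟨by omega, le_rfl⟩)
    rcases eq_or_ne (M.hilb m) 0 with h0 | h0
    · rw [h0, Nat.cast_zero]; positivity
    · have h0' : (0 : ℝ) < M.hilb m := by exact_mod_cast Nat.pos_of_ne_zero h0
      refine hS.trans ?_
      have : Real.log (∑ i ∈ Finset.Icc (-(m : ℤ)) m, (M.hilb i : ℝ)) ≤ Real.log ((m : ℝ) ^ 2) := by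
        rw [Real.log_pow]; push_cast; exact hm.le
      exact (Real.log_le_log_iff (h0'.trans_le hS) (by positivity)).1 this
  obtain ⟨N, hN⟩ := M.exists_lower_bound
  refine Summable.of_nat_of_neg ?_ ?_
  · have hs := summable_pow_mul_geometric_of_norm_lt_one 2 (r := t)
      (by rwa [Real.norm_of_nonneg ht0.le])
    refine Summable.of_norm_bounded_eventually_nat hs ?_
    filter_upwards [hle] with m hm
    rw [Real.norm_of_nonneg (by positivity), zpow_natCast]
    gcongr
  · refine summable_of_ne_finset_zero (s := Finset.range ((-N).toNat + 1)) fun m hm => ?_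
    rw [Finset.mem_range] at hm
    have : M.deg (-(m : ℤ)) = ⊥ := hN _ (by omega)
    rw [GrMod.hilb, this]
    simp

lemma tendsto_one_sub_div_one_sub_pow {D : ℕ} (hD : 0 < D) :
    Tendsto (fun t : ℝ => (1 - t) * (1 - t ^ D)⁻¹) (𝓝[<] 1) (𝓝 (D : ℝ)⁻¹) := by
  have h1 : Tendsto (fun t : ℝ => (∑ i ∈ Finset.range D, t ^ i)⁻¹) (𝓝[<] 1) (𝓝 (D : ℝ)⁻¹) := by
    have hc : Continuous fun t : ℝ => ∑ i ∈ Finset.range D, t ^ i := by fun_prop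
    have := (hc.tendsto 1).mono_left (nhdsWithin_le_nhds (s := Set.Iio 1))
    simp only [one_pow, Finset.sum_const, Finset.card_range, nsmul_eq_mul, mul_one] at this
    exact this.inv₀ (by positivity)
  refine h1.congr' ?_
  filter_upwards [self_mem_nhdsWithin] with t (ht : t < 1)
  have h2 : 1 - t ≠ 0 := by linarith
  rw [← geom_sum_mul_neg t D]
  rw [mul_inv, mul_comm, mul_assoc, inv_mul_cancel₀ h2, mul_one]

/-- Growth along steps of `D` bounds the Hilbert series below by dim(M_i) t^i / (1 - t^D), and (1 -
t)/(1 - t^D) → 1/D. This is how the multiplicity bounds individual dimensions. -/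
lemma GrMod.hilb_le_of_hasMultiplicity (M : GrMod k (hypGrading w q)) (h1 : M.gkdim = 1) {e : ℝ}
    (he : M.HasMultiplicity e) {D : ℕ} (hD : 0 < D) (hinc : ∀ i, M.hilb i ≤ M.hilb (i + D))
    (i : ℤ) : (M.hilb i : ℝ) ≤ D * e := by
  have hinc' : ∀ s : ℕ, M.hilb i ≤ M.hilb (i + D * s) := by
    intro s
    induction s with
    | zero => simp
    | succ s ih =>
      refine ih.trans ((hinc _).trans (le_of_eq ?_))
      congr 1; push_cast; ring
  have hlow : Tendsto (fun t : ℝ => (M.hilb i : ℝ) * t ^ i * ((1 - t) * (1 - t ^ D)⁻¹)) (𝓝[<] 1)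
      (𝓝 ((M.hilb i : ℝ) * 1 ^ i * (D : ℝ)⁻¹)) := by
    refine Tendsto.mul (Tendsto.const_mul _ ?_) (tendsto_one_sub_div_one_sub_pow hD)
    exact (continuousAt_zpow₀ 1 i (Or.inl one_ne_zero)).tendsto.mono_left nhdsWithin_le_nhds
  have hle := le_of_tendsto_of_tendsto hlow he ?_
  · have hD' : (0 : ℝ) < D := by exact_mod_cast hD
    rw [one_zpow, mul_one, mul_inv_le_iff₀ hD'] at hle
    linarith
  · have h01 : ∀ᶠ t : ℝ in 𝓝[<] 1, 0 < t :=
      nhdsWithin_le_nhds (lt_mem_nhds zero_lt_one)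
    filter_upwards [self_mem_nhdsWithin, h01] with t (ht1 : t < 1) ht0
    have hsum := M.summable_hilb h1 ht0 ht1
    have hinj : Function.Injective fun s : ℕ => i + (D : ℤ) * s := by
      intro s s' h
      have hD' : (D : ℤ) ≠ 0 := by exact_mod_cast hD.ne'
      have h2 : (D : ℤ) * s = D * s' := by simpa using h
      exact_mod_cast mul_left_cancel₀ hD' h2
    have htD : t ^ D < 1 := pow_lt_one₀ ht0.le ht1 hD.ne'
    have hgeo := (hasSum_geometric_of_lt_one (by positivity) htD).mul_left ((M.hilb i : ℝ) * t ^ i)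
    have hge : (M.hilb i : ℝ) * t ^ i * (1 - t ^ D)⁻¹ ≤ ∑' i : ℤ, (M.hilb i : ℝ) * t ^ i := by
      refine hasSum_le_inj _ hinj (fun c _ => by positivity) (fun s => ?_) hgeo hsum.hasSum
      have : t ^ (i + (D : ℤ) * s) = t ^ i * (t ^ D) ^ s := by
        rw [zpow_add₀ ht0.ne', zpow_mul, zpow_natCast, zpow_natCast]
      rw [this, ← mul_assoc]
      gcongr
      exact hinc' s
    calc (M.hilb i : ℝ) * t ^ i * ((1 - t) * (1 - t ^ D)⁻¹)
        = (1 - t) * ((M.hilb i : ℝ) * t ^ i * (1 - t ^ D)⁻¹) := by ring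
      _ ≤ _ := mul_le_mul_of_nonneg_left hge (by linarith)

lemma GrMod.gen_smul_comm (M : GrMod k (hypGrading w q)) (i j : Fin n) (m : M.carrier) :
    op (gen w q i) • op (gen w q j) • m = q j i • op (gen w q j) • op (gen w q i) • m := by
  rw [← mul_smul, ← op_mul, gen_mul_gen i j, op_smul, op_mul, smul_assoc, mul_smul]

lemma GrMod.gen_smul_mem (M : GrMod k (hypGrading w q)) {d : ℤ} {m : M.carrier}
    (hm : m ∈ M.deg d) (i : Fin n) : op (gen w q i) • m ∈ M.deg (d + w i) :=
  M.smul_mem d _ m _ hm (gen_mem i)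

lemma GrMod.sum_gen_pow_smul (M : GrMod k (hypGrading w q)) (m : M.carrier) :
    ∑ i, op (gen w q i) ^ expo w i • m = 0 := by
  rw [← Finset.sum_smul]
  have h : op (∑ i, gen w q i ^ expo w i) = 0 := by rw [sum_gen_pow, op_zero]
  rw [← MulOpposite.opAddEquiv_apply, map_sum] at h
  simp only [MulOpposite.opAddEquiv_apply, op_pow] at h
  rw [h, zero_smul]

lemma GrMod.word_gen_smul (hq : ∀ i j, q i j ≠ 0) (M : GrMod k (hypGrading w q)) (i : Fin n)
    (l : List (Fin n)) : ∃ c : k, c ≠ 0 ∧ ∀ m : M.carrier,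
      op (gen w q i) • op (word w q l) • m = c • op (word w q l) • op (gen w q i) • m := by
  obtain ⟨c, hc, h⟩ := word_mul_gen (w := w) hq i l
  refine ⟨c, hc, fun m => ?_⟩
  rw [← mul_smul, ← op_mul, h, op_smul, op_mul, smul_assoc, mul_smul]

/-- A generator acts on a `1`-critical module either as zero or injectively. -/
lemma GrMod.IsOneCritical.gen_smul_eq_zero_or (hw : ∀ i, 0 < w i) (hq : ∀ i j, q i j ≠ 0)
    {M : GrMod k (hypGrading w q)} (hM : M.IsOneCritical) (i : Fin n) :
    (∀ m : M.carrier, op (gen w q i) • m = 0) ∨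
      ∀ d, ∀ m ∈ M.deg d, op (gen w q i) • m = 0 → m = 0 := by
  by_cases hinj : ∀ d, ∀ m ∈ M.deg d, op (gen w q i) • m = 0 → m = 0
  · exact Or.inr hinj
  left
  push Not at hinj
  obtain ⟨d, m, hm, hm0, hne⟩ := hinj
  obtain ⟨N, hN⟩ := hM.eventually_le_span hw hm hne
  -- The killed element generates all large degrees, and x_i passes through words up to scalars, so
  -- x_i vanishes on all large degrees. Consequently the image of x_i is torsion, hence zero.
  have hker : ∀ j ≥ N, ∀ x ∈ M.deg j, op (gen w q i) • x = 0 := by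
    intro j hj x hx
    have := hN j hj x hx
    clear hx
    induction this using Submodule.span_induction with
    | mem x hx =>
      obtain ⟨l, -, rfl⟩ := hx
      obtain ⟨c, -, hc⟩ := M.word_gen_smul hq i l
      rw [hc, hm0, smul_zero, smul_zero]
    | zero => simp
    | add x y _ _ hx hy => rw [smul_add, hx, hy, add_zero]
    | smul c x _ hx => rw [smul_comm, hx, smul_zero]
  intro x
  induction x using M.induction_homogeneous with
  | hom e x hx =>
    refine hM.eq_zero_of_torsion hw (M.gen_smul_mem hx i) (N - e).toNat fun l hl => ?_
    obtain ⟨c, hc0, hc⟩ := M.word_gen_smul hq i l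
    have h1 := hc x
    rw [hker _ (by omega) _ (M.word_smul_mem hx l)] at h1
    exact (smul_eq_zero.1 h1.symm).resolve_left hc0
  | add x y hx hy => rw [smul_add, hx, hy, add_zero]

/-- A bounded nondecreasing sequence of natural numbers is eventually constant; this is applied to
each of the `D` residue classes and the largest threshold is kept. -/
lemma exists_stable_of_bounded {h : ℤ → ℕ} {D : ℕ} (hD : 0 < D) (hinc : ∀ i, h i ≤ h (i + D))
    (B : ℕ) (hB : ∀ i, h i ≤ B) : ∃ N : ℤ, ∀ i ≥ N, h (i + D) = h i := by
  have hstab : ∀ i : ℤ, ∃ T : ℕ, ∀ t ≥ T, h (i + (D : ℤ) * (t + 1 : ℕ)) = h (i + D * t) := by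
    intro i
    let f : ℕ → ℕ := fun t => h (i + D * t)
    have hmono : Monotone f := monotone_nat_of_le_succ fun t => by
      refine (hinc _).trans (le_of_eq ?_)
      change h _ = h _
      congr 1; push_cast; ring
    have hbdd : BddAbove (Set.range f) := ⟨B, by rintro _ ⟨t, rfl⟩; exact hB _⟩
    obtain ⟨T, hT⟩ := Nat.sSup_mem (Set.range_nonempty f) hbdd
    have hmax : ∀ t ≥ T, f t = f T := fun t ht =>
      le_antisymm (hT ▸ le_csSup hbdd ⟨t, rfl⟩) (hmono ht)
    exact ⟨T, fun t ht => (hmax (t + 1) (by omega)).trans (hmax t ht).symm⟩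
  choose T hT using hstab
  obtain ⟨U, hU⟩ := ((Finset.range D).finite_toSet.image fun r : ℕ => T (r : ℤ)).bddAbove
  refine ⟨D * (U + 1), fun i hi => ?_⟩
  have hD' : (0 : ℤ) < D := by exact_mod_cast hD
  have h1 := Int.emod_add_mul_ediv i D
  have h2 := Int.emod_nonneg i hD'.ne'
  have h3 := Int.emod_lt_of_pos i hD'
  have h4 : (U : ℤ) + 1 ≤ i / D := by rw [Int.le_ediv_iff_mul_le hD']; linarith
  obtain ⟨r, hr⟩ := Int.eq_ofNat_of_zero_le h2
  obtain ⟨t, ht⟩ := Int.eq_ofNat_of_zero_le (show 0 ≤ i / D by omega)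
  rw [hr, ht] at h1
  have h5 : T r ≤ U := hU ⟨r, by simp; omega, rfl⟩
  have h6 := hT r t (by omega)
  rw [← h1, ← h6]
  congr 1; push_cast; ring

lemma GrMod.hilb_le_of_injective (hw : ∀ i, 0 < w i) (M : GrMod k (hypGrading w q)) {i : Fin n}
    (hi : ∀ d, ∀ m ∈ M.deg d, op (gen w q i) • m = 0 → m = 0) (d : ℤ) :
    M.hilb d ≤ M.hilb (d + w i) := by
  have := M.finite_deg hw (d + w i)
  let φ : M.deg d →ₗ[k] M.deg (d + w i) :=
    { toFun := fun m => ⟨op (gen w q i) • m.1, M.gen_smul_mem m.2 i⟩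
      map_add' := fun x y => Subtype.ext (smul_add _ _ _)
      map_smul' := fun c x => Subtype.ext (smul_comm _ _ _) }
  refine LinearMap.finrank_le_finrank_of_injective (f := φ) ?_
  rw [← LinearMap.ker_eq_bot, LinearMap.ker_eq_bot']
  rintro ⟨m, hm⟩ h0
  exact Subtype.ext (hi d m hm (congrArg Subtype.val h0))

end Critical

/-! ### Point modules -/

section Point

variable {k : Type u} [Field k] {n : ℕ}

/-- Structure constants of a module with a basis `e_0, e_1, …`, where `e_s` has degree `r + g s`
and `e_s x_i = c_i(s) e_{s + b_i}`. -/
structure PointData (w : Fin n → ℕ) (q : Fin n → Fin n → k) where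
  g : ℕ
  r : ℤ
  b : Fin n → ℕ
  c : Fin n → ℕ → k
  period : ℕ
  g_pos : 0 < g
  expo_pos : ∀ i, 0 < expo w i
  zero_or : ∀ i, (∀ s, c i s = 0) ∨
    ((∀ s, c i s ≠ 0) ∧ w i = g * b i ∧ expo w i * b i = period)
  comm : ∀ i j s, c j s * c i (s + b j) = q j i * (c i s * c j (s + b i))
  hyp : ∀ s, ∑ i, ∏ t ∈ Finset.range (expo w i), c i (s + t * b i) = 0
  exists_coprime : ∃ i j, (∀ s, c i s ≠ 0) ∧ (∀ s, c j s ≠ 0) ∧ 0 < b i ∧ 0 < b j ∧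
    Nat.Coprime (b i) (b j)

namespace PointData

variable {w : Fin n → ℕ} {q : Fin n → Fin n → k} (d : PointData w q)

/-- The action of the generator `x_i` on the underlying vector space of a point module. -/
def opr (i : Fin n) : Module.End k (ℕ →₀ k) :=
  Finsupp.linearCombination k fun s => Finsupp.single (s + d.b i) (d.c i s)

lemma opr_single (i : Fin n) (s : ℕ) (a : k) :
    d.opr i (Finsupp.single s a) = Finsupp.single (s + d.b i) (a * d.c i s) := by
  simp [opr]

lemma opr_pow_single (i : Fin n) (t s : ℕ) (a : k) :
    (d.opr i ^ t) (Finsupp.single s a) =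
      Finsupp.single (s + t * d.b i) (a * ∏ u ∈ Finset.range t, d.c i (s + u * d.b i)) := by
  induction t with
  | zero => simp
  | succ t ih =>
    rw [pow_succ', Module.End.mul_apply, ih, opr_single, Finset.prod_range_succ]
    congr 1 <;> ring

/-- The representation of the algebra on the underlying vector space of a point module. -/
def rep : HypAlg w q →ₐ[k] (Module.End k (ℕ →₀ k))ᵐᵒᵖ :=
  RingQuot.liftAlgHom k ⟨FreeAlgebra.lift k fun i => op (d.opr i), by
    rintro x y (⟨i, j⟩ | _)
    · simp only [map_mul, FreeAlgebra.lift_ι_apply, map_smul, ← op_mul, ← op_smul]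
      congr 1
      refine Finsupp.lhom_ext fun s a => ?_
      simp only [Module.End.mul_apply, LinearMap.smul_apply, opr_single, Finsupp.smul_single,
        smul_eq_mul]
      rw [show s + d.b i + d.b j = s + d.b j + d.b i by ring]
      congr 1
      have := d.comm i j s
      linear_combination a * this
    · simp only [map_sum, map_pow, FreeAlgebra.lift_ι_apply, map_zero]
      apply unop_injective
      rw [← MulOpposite.opAddEquiv_symm_apply, map_sum]
      simp only [MulOpposite.opAddEquiv_symm_apply, unop_pow, unop_op, unop_zero]
      refine Finsupp.lhom_ext fun s a => ?_
      rw [LinearMap.sum_apply, LinearMap.zero_apply]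
      -- An inactive generator contributes the coefficient 0, so its terms may be placed at index `s
      -- + d.period` too; the action of f then collapses to the scalar identity `hyp`.
      have h1 : ∀ i, (d.opr i ^ expo w i) (Finsupp.single s a) =
          Finsupp.single (s + d.period)
            (a * ∏ u ∈ Finset.range (expo w i), d.c i (s + u * d.b i)) := by
        intro i
        rw [opr_pow_single]
        rcases d.zero_or i with h | h
        · have h0 : ∏ u ∈ Finset.range (expo w i), d.c i (s + u * d.b i) = 0 :=
            Finset.prod_eq_zero (Finset.mem_range.2 (d.expo_pos i)) (h _)
          simp [h0]
        · rw [h.2.2]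
      simp_rw [h1]
      rw [← Finsupp.single_finsetSum, ← Finset.mul_sum, d.hyp s, mul_zero, Finsupp.single_zero]⟩

lemma rep_gen (i : Fin n) : d.rep (gen w q i) = op (d.opr i) := by
  simp [rep, gen]

/-- The opposite ring acts by `k`-linear endomorphisms. -/
def opRep : (HypAlg w q)ᵐᵒᵖ →ₐ[k] Module.End k (ℕ →₀ k) := AlgHom.opComm d.rep

lemma opRep_gen (i : Fin n) : d.opRep (op (gen w q i)) = d.opr i := by
  change unop (d.rep (gen w q i)) = _
  rw [rep_gen, unop_op]

lemma opRep_word_mem (l : List (Fin n)) {i : ℤ} {v : ℕ →₀ k}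
    (hv : v ∈ Finsupp.supported k k {s : ℕ | d.r + d.g * s = i}) :
    d.opRep (op (word w q l)) v ∈
      Finsupp.supported k k {s : ℕ | d.r + d.g * s = i + (wt w l : ℤ)} := by
  induction l generalizing i v with
  | nil => simpa using hv
  | cons a l ih =>
    rw [word_cons, op_mul, map_mul, opRep_gen, Module.End.mul_apply, wt_cons, Nat.cast_add,
      ← add_assoc]
    refine ih ?_
    rw [Finsupp.supported_eq_span_single] at hv
    induction hv using Submodule.span_induction with
    | mem x hx =>
      obtain ⟨s, hs, rfl⟩ := hx
      rw [opr_single]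
      rcases d.zero_or a with h | h
      · rw [h, mul_zero, Finsupp.single_zero]; exact zero_mem _
      · refine Finsupp.single_mem_supported k _ ?_
        change d.r + d.g * s = i at hs
        change d.r + (d.g : ℤ) * ((s + d.b a : ℕ) : ℤ) = i + w a
        rw [h.2.1, ← hs]; push_cast; ring
    | zero => simp
    | add x y _ _ hx hy => rw [map_add]; exact add_mem hx hy
    | smul c x _ hx => rw [map_smul]; exact Submodule.smul_mem _ _ hx

/-- The point module with given structure constants. -/
def toGrMod : GrMod k (hypGrading w q) :=
  letI : Module (HypAlg w q)ᵐᵒᵖ (ℕ →₀ k) := Module.compHom _ d.opRep.toRingHom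
  { carrier := ℕ →₀ k
    isScalarTower := ⟨fun c r v => by
      change d.opRep (c • r) v = c • d.opRep r v
      rw [map_smul]; rfl⟩
    deg := fun i => Finsupp.supported k k {s : ℕ | d.r + d.g * s = i}
    isInternal := by
      refine DirectSum.isInternal_submodule_of_iSupIndep_of_iSup_eq_top ?_ ?_
      · intro i
        have hle : (⨆ j, ⨆ (_ : j ≠ i), Finsupp.supported k k {s : ℕ | d.r + d.g * s = j}) ≤
            Finsupp.supported k k {s : ℕ | d.r + d.g * s = i}ᶜ :=
          iSup₂_le fun j hj => Finsupp.supported_mono fun s hs hs' => hj (Eq.trans (Eq.symm hs) hs')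
        exact (Finsupp.disjoint_supported_supported disjoint_compl_right).mono_right hle
      · have h : (⋃ i : ℤ, {s : ℕ | d.r + d.g * s = i}) = Set.univ :=
          Set.iUnion_eq_univ_iff.2 fun s => ⟨d.r + d.g * s, rfl⟩
        rw [← Finsupp.supported_iUnion, h, Finsupp.supported_univ]
    smul_mem := by
      intro i j v r hv hr
      change d.opRep (op r) v ∈ _
      rw [hypGrading_eq] at hr
      induction hr using Submodule.span_induction with
      | mem x hx =>
        obtain ⟨l, rfl, rfl⟩ := hx
        exact d.opRep_word_mem l hv
      | zero => simp
      | add x y _ _ hx hy =>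
        rw [MulOpposite.op_add, map_add]; exact add_mem hx hy
      | smul c x _ hx => rw [op_smul, map_smul]; exact Submodule.smul_mem _ _ hx
    finite := by
      obtain ⟨i, -, hi, -, hb, -⟩ := d.exists_coprime
      classical
      -- An active x_i moves indices by `b i` with nonzero coefficients, so the first `b i` basis
      -- vectors generate.
      refine ⟨⟨(Finset.range (d.b i)).image fun s => Finsupp.single s 1, ?_⟩⟩
      set K := Submodule.span (HypAlg w q)ᵐᵒᵖ
        (((Finset.range (d.b i)).image fun s => Finsupp.single s (1 : k) : Finset (ℕ →₀ k)) :
          Set (ℕ →₀ k)) with hK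
      have hsingle : ∀ s a, Finsupp.single s a ∈ K := by
        intro s
        induction s using Nat.strong_induction_on with
        | _ s ih =>
          intro a
          by_cases hs : s < d.b i
          · have h1 : Finsupp.single s (1 : k) ∈ K :=
              Submodule.subset_span (Finset.mem_coe.2 (Finset.mem_image.2
                ⟨s, Finset.mem_range.2 hs, rfl⟩))
            have h2 : algebraMap k (HypAlg w q)ᵐᵒᵖ a • Finsupp.single s (1 : k) =
                Finsupp.single s a := by
              change d.opRep (algebraMap k (HypAlg w q)ᵐᵒᵖ a) _ = _
              rw [AlgHom.commutes, Module.algebraMap_end_apply, Finsupp.smul_single, smul_eq_mul,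
                mul_one]
            rw [← h2]
            exact Submodule.smul_mem _ _ h1
          · have h2 : op (gen w q i) • Finsupp.single (s - d.b i) (a * (d.c i (s - d.b i))⁻¹) =
                Finsupp.single s a := by
              change d.opRep (op (gen w q i)) _ = _
              rw [opRep_gen, opr_single, Nat.sub_add_cancel (not_lt.1 hs), mul_assoc,
                inv_mul_cancel₀ (hi _), mul_one]
            rw [← h2]
            exact Submodule.smul_mem _ _ (ih _ (by omega) _)
      rw [eq_top_iff]
      rintro v -
      induction v using Finsupp.induction_linear with
      | zero => exact zero_mem _
      | add x y hx hy => exact add_mem hx hy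
      | single s a => exact hsingle s a }

/-- The basis vector `e_s` of a point module. -/
def e (s : ℕ) : d.toGrMod.carrier := (Finsupp.single s 1 : ℕ →₀ k)

lemma gen_smul_e (i : Fin n) (s : ℕ) :
    op (gen w q i) • d.e s = d.c i s • d.e (s + d.b i) := by
  change d.opRep (op (gen w q i)) (Finsupp.single s 1) = d.c i s • (Finsupp.single _ 1 : ℕ →₀ k)
  rw [opRep_gen, opr_single, Finsupp.smul_single, one_mul, smul_eq_mul, mul_one]

lemma e_ne_zero (s : ℕ) : d.e s ≠ 0 := by
  change (Finsupp.single s 1 : ℕ →₀ k) ≠ 0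
  simp

lemma e_mem (s : ℕ) : d.e s ∈ d.toGrMod.deg (d.r + d.g * s) :=
  Finsupp.single_mem_supported k _ rfl

lemma mem_deg_iff {s : ℕ} {v : d.toGrMod.carrier} :
    v ∈ d.toGrMod.deg (d.r + d.g * s) ↔ ∃ a : k, v = a • d.e s := by
  constructor
  · intro hv
    have h : {t : ℕ | d.r + (d.g : ℤ) * t = d.r + d.g * s} = {s} := by
      ext t
      have := d.g_pos
      simp
      omega
    have key : ∀ v ∈ Finsupp.supported k k {t : ℕ | d.r + (d.g : ℤ) * t = d.r + d.g * s},
        ∃ a : k, a • Finsupp.single s 1 = v := by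
      intro v hv
      rw [h, Finsupp.supported_eq_span_single, Set.image_singleton] at hv
      exact Submodule.mem_span_singleton.1 hv
    obtain ⟨a, ha⟩ := key v hv
    exact ⟨a, ha.symm⟩
  · rintro ⟨a, rfl⟩
    exact Submodule.smul_mem _ _ (d.e_mem s)

lemma deg_eq_bot {i : ℤ} (h : ∀ s : ℕ, d.r + d.g * s ≠ i) : d.toGrMod.deg i = ⊥ := by
  change Finsupp.supported k k {t : ℕ | d.r + (d.g : ℤ) * t = i} = ⊥
  have : {t : ℕ | d.r + (d.g : ℤ) * t = i} = ∅ := by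
    ext t
    simpa using h t
  rw [this, Finsupp.supported_empty]

lemma hilb_eq_one (s : ℕ) : d.toGrMod.hilb (d.r + d.g * s) = 1 := by
  have : d.toGrMod.deg (d.r + d.g * s) = Submodule.span k {d.e s} := by
    ext v
    rw [d.mem_deg_iff, Submodule.mem_span_singleton]
    simp only [eq_comm]
  rw [GrMod.hilb, this]
  exact finrank_span_singleton (d.e_ne_zero s)

lemma hilb_eq_zero {i : ℤ} (h : ∀ s : ℕ, d.r + d.g * s ≠ i) : d.toGrMod.hilb i = 0 := by
  rw [GrMod.hilb, d.deg_eq_bot h]; simp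

lemma hilb_le_one (i : ℤ) : d.toGrMod.hilb i ≤ 1 := by
  by_cases h : ∃ s : ℕ, d.r + d.g * s = i
  · obtain ⟨s, rfl⟩ := h
    exact (d.hilb_eq_one s).le
  · push Not at h
    rw [d.hilb_eq_zero h]; exact zero_le_one

lemma induction_e {motive : d.toGrMod.carrier → Prop} (smul : ∀ (a : k) s, motive (a • d.e s))
    (add : ∀ x y, motive x → motive y → motive (x + y)) (v : d.toGrMod.carrier) : motive v := by
  refine Finsupp.induction_linear (M := k) (motive := motive) v ?_ add ?_
  · have := smul 0 0
    rwa [zero_smul] at this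
  · intro s a
    have : (a • d.e s : d.toGrMod.carrier) = (Finsupp.single s a : ℕ →₀ k) := by
      exact (Finsupp.smul_single a s 1).trans (by rw [smul_eq_mul, mul_one])
    rw [← this]
    exact smul a s

/-- The Hilbert series is t^r / (1 - t^g); the point is thin exactly when g > 1. -/
lemma hasMultiplicity : d.toGrMod.HasMultiplicity (d.g : ℝ)⁻¹ := by
  have h1 : Tendsto (fun t : ℝ => t ^ d.r * ((1 - t) * (1 - t ^ d.g)⁻¹)) (𝓝[<] 1)
      (𝓝 (1 ^ d.r * (d.g : ℝ)⁻¹)) := by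
    refine Tendsto.mul ?_ (tendsto_one_sub_div_one_sub_pow d.g_pos)
    exact (continuousAt_zpow₀ 1 _ (Or.inl one_ne_zero)).tendsto.mono_left nhdsWithin_le_nhds
  rw [one_zpow, one_mul] at h1
  refine h1.congr' ?_
  have h01 : ∀ᶠ t : ℝ in 𝓝[<] 1, 0 < t := nhdsWithin_le_nhds (lt_mem_nhds zero_lt_one)
  filter_upwards [self_mem_nhdsWithin, h01] with t (ht1 : t < 1) ht0
  have hinj : Function.Injective fun s : ℕ => d.r + (d.g : ℤ) * s := by
    intro s s' h
    have := d.g_pos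
    simp at h
    omega
  have htg : t ^ d.g < 1 := pow_lt_one₀ ht0.le ht1 d.g_pos.ne'
  have hts : ∑' i : ℤ, (d.toGrMod.hilb i : ℝ) * t ^ i = t ^ d.r * (1 - t ^ d.g)⁻¹ := by
    rw [← tsum_geometric_of_lt_one (by positivity) htg, ← tsum_mul_left]
    rw [← hinj.tsum_eq]
    · refine tsum_congr fun s => ?_
      rw [d.hilb_eq_one, Nat.cast_one, one_mul, zpow_add₀ ht0.ne', zpow_mul, zpow_natCast,
        zpow_natCast]
    · intro i hi
      by_contra h
      have : ∀ s : ℕ, d.r + d.g * s ≠ i := fun s hs => h ⟨s, hs⟩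
      exact hi (by simp [d.hilb_eq_zero this])
  rw [hts]; ring

lemma pow_gen_smul_e (i : Fin n) (t s : ℕ) :
    op (gen w q i) ^ t • d.e s =
      (∏ u ∈ Finset.range t, d.c i (s + u * d.b i)) • d.e (s + t * d.b i) := by
  induction t with
  | zero => simp
  | succ t ih =>
    rw [pow_succ', mul_smul, ih, smul_comm, gen_smul_e, smul_smul, Finset.prod_range_succ]
    congr 2; ring

lemma isOneCritical (hw : ∀ i, 0 < w i) : d.toGrMod.IsOneCritical := by
  refine ⟨le_antisymm (d.toGrMod.gkdim_le_one d.hilb_le_one) ?_, ?_⟩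
  · refine d.toGrMod.one_le_gkdim hw d.g d.g_pos d.r fun i hi => ?_
    have hg : (0 : ℤ) < d.g := by exact_mod_cast d.g_pos
    obtain ⟨s, hs⟩ := Int.eq_ofNat_of_zero_le (show 0 ≤ (i - d.r + d.g - 1) / d.g from
      Int.ediv_nonneg (by omega) hg.le)
    have h1 := Int.emod_add_mul_ediv (i - d.r + d.g - 1) d.g
    have h2 := Int.emod_nonneg (i - d.r + d.g - 1) hg.ne'
    have h3 := Int.emod_lt_of_pos (i - d.r + d.g - 1) hg
    rw [hs] at h1
    refine ⟨d.r + d.g * s, by omega, by omega, fun h => ?_⟩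
    have := d.e_mem s
    rw [h] at this
    exact d.e_ne_zero s ((Submodule.mem_bot k).1 this)
  · intro P p hsurj hinj
    obtain ⟨i, j, hi, hj, hbi, hbj, hcop⟩ := d.exists_coprime
    -- The kernel is graded and nonzero components are lines, so a nonzero kernel contains some
    -- basis vector.
    have hs : ∃ s, GrMod.Hom.toLin p (d.e s) = 0 := by
      by_contra! hne
      apply hinj
      rw [injective_iff_map_eq_zero]
      intro v hv
      by_contra hv0
      obtain ⟨a, ha⟩ := d.toGrMod.exists_pr_ne_zero hv0
      by_cases h : ∃ s : ℕ, d.r + d.g * s = a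
      · obtain ⟨s, rfl⟩ := h
        obtain ⟨c, hc⟩ := d.mem_deg_iff.1 (d.toGrMod.pr_mem _ v)
        have h1 := GrMod.Hom.toLin_pr p (d.r + d.g * s) v
        rw [hv, map_zero, hc, GrMod.Hom.toLin_smul] at h1
        rcases smul_eq_zero.1 h1 with h2 | h2
        · rw [hc, h2, zero_smul] at ha; exact ha rfl
        · exact hne s h2
      · push Not at h
        have := d.toGrMod.pr_mem a v
        rw [d.deg_eq_bot h] at this
        exact ha ((Submodule.mem_bot k).1 this)
    obtain ⟨s, hs⟩ := hs
    have hstep : ∀ i, (∀ s, d.c i s ≠ 0) → ∀ t s, GrMod.Hom.toLin p (d.e s) = 0 →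
        GrMod.Hom.toLin p (d.e (s + t * d.b i)) = 0 := by
      intro i hi t s hs
      have h1 := congrArg (GrMod.Hom.toLin p) (d.pow_gen_smul_e i t s)
      rw [map_smul, hs, smul_zero, GrMod.Hom.toLin_smul] at h1
      exact (smul_eq_zero.1 h1.symm).resolve_left (Finset.prod_ne_zero_iff.2 fun u _ => hi _)
    -- Coprime steps `b i` and `b j` reach every index from (b_i - 1)(b_j - 1) on, the conductor of
    -- the numerical semigroup they generate.
    have hev : ∀ s' ≥ s + (d.b i).pred * (d.b j).pred, GrMod.Hom.toLin p (d.e s') = 0 := by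
      intro s' hs'
      obtain ⟨x, y, hxy⟩ := Nat.exists_add_mul_eq_of_gcd_dvd_of_mul_pred_le (d.b i) (d.b j)
        (s' - s) (by rw [hcop]; exact one_dvd _) (by omega)
      have h1 := hstep j hj y _ (hstep i hi x _ hs)
      have h2 : s + x * d.b i + y * d.b j = s' := by omega
      rwa [h2] at h1
    refine P.gkdim_lt_one_of_eventually_zero
      (d.r + d.g * (s + (d.b i).pred * (d.b j).pred : ℕ)) fun a ha => ?_
    rw [Submodule.eq_bot_iff]
    intro y hy
    obtain ⟨v, rfl⟩ := hsurj y
    rw [← P.pr_of_mem hy, ← GrMod.Hom.toLin_pr]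
    by_cases h : ∃ s : ℕ, d.r + d.g * s = a
    · obtain ⟨s', rfl⟩ := h
      obtain ⟨c, hc⟩ := d.mem_deg_iff.1 (d.toGrMod.pr_mem _ v)
      have hg : (0 : ℤ) < d.g := by exact_mod_cast d.g_pos
      have : s + (d.b i).pred * (d.b j).pred ≤ s' := by
        have h3 := le_of_mul_le_mul_left (by linarith :
          (d.g : ℤ) * (s + (d.b i).pred * (d.b j).pred : ℕ) ≤ d.g * s') hg
        exact_mod_cast h3
      rw [hc, GrMod.Hom.toLin_smul, hev s' this, smul_zero]
    · push Not at h
      have := d.toGrMod.pr_mem a v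
      rw [d.deg_eq_bot h] at this
      rw [(Submodule.mem_bot k).1 this, map_zero]

/-- The closed point of `proj` represented by a point module. -/
def point : Quotient (isIsomorphicSetoid (Qgr k (hypGrading w q))) :=
  Quotient.mk (isIsomorphicSetoid (Qgr k (hypGrading w q)))
    ((proj k (hypGrading w q)).obj d.toGrMod)

lemma point_mem (hw : ∀ i, 0 < w i) : d.point ∈ ordinaryThinPoints k (hypGrading w q) := by
  refine ⟨d.toGrMod, d.isOneCritical hw, ⟨_, d.hasMultiplicity, ?_⟩, rfl⟩
  exact inv_le_one_of_one_le₀ (by exact_mod_cast d.g_pos)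

end PointData
end Point

/-! ### Comparison of point modules -/

section Compare

variable {k : Type u} [Field k] {n : ℕ} {w : Fin n → ℕ} {q : Fin n → Fin n → k}

namespace PointData

variable (d : PointData w q)

/-- The linear map from a point module determined by the images of the basis vectors. -/
def liftBase {M : GrMod k (hypGrading w q)} (v : ℕ → M.carrier) :
    d.toGrMod.carrier →ₗ[k] M.carrier :=
  (Finsupp.linearCombination k v : (ℕ →₀ k) →ₗ[k] M.carrier)

lemma liftBase_e {M : GrMod k (hypGrading w q)} (v : ℕ → M.carrier) (s : ℕ) :
    d.liftBase v (d.e s) = v s := by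
  change Finsupp.linearCombination k v (Finsupp.single s 1) = v s
  simp

/-- The morphism from a point module determined by the images of the basis vectors. -/
def lift {M : GrMod k (hypGrading w q)} (v : ℕ → M.carrier)
    (hv : ∀ s : ℕ, v s ∈ M.deg (d.r + d.g * s))
    (hact : ∀ i s, op (gen w q i) • v s = d.c i s • v (s + d.b i)) : d.toGrMod ⟶ M :=
  GrMod.Hom.mk (M := d.toGrMod) (N := M)
    { toFun := d.liftBase v
      map_add' := map_add _
      map_smul' := by
        intro r x
        obtain ⟨r, rfl⟩ := op_surjective r
        rw [RingHom.id_apply]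
        induction r using induction_words generalizing x with
        | word l =>
          induction l generalizing x with
          | nil => simp
          | cons i l ih =>
            rw [word_cons, op_mul, mul_smul, mul_smul, ih]
            congr 1
            induction x using d.induction_e with
            | smul a s =>
              rw [smul_comm, d.gen_smul_e, map_smul, map_smul, map_smul, liftBase_e, liftBase_e,
                smul_comm (op (gen w q i)), hact]
            | add x y hx hy => rw [smul_add, map_add, hx, hy, map_add, smul_add]
        | zero => simp
        | add r s hr hs => rw [MulOpposite.op_add, add_smul, map_add, hr, hs, add_smul]
        | smul c r hr => rw [op_smul, smul_assoc, map_smul, hr, smul_assoc] }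
    (by
      intro i m hm
      change d.liftBase v m ∈ M.deg i
      by_cases h : ∃ s : ℕ, d.r + d.g * s = i
      · obtain ⟨s, rfl⟩ := h
        obtain ⟨a, rfl⟩ := d.mem_deg_iff.1 hm
        rw [map_smul, liftBase_e]
        exact Submodule.smul_mem _ _ (hv s)
      · push Not at h
        rw [d.deg_eq_bot h] at hm
        rw [(Submodule.mem_bot k).1 hm, map_zero]
        exact zero_mem _)

/-- A module that looks like a point module in large degrees represents the same point. -/
lemma point_eq {M : GrMod k (hypGrading w q)} (v : ℕ → M.carrier)
    (hv : ∀ s : ℕ, v s ∈ M.deg (d.r + d.g * s)) (hv0 : ∀ s, v s ≠ 0)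
    (hact : ∀ i s, op (gen w q i) • v s = d.c i s • v (s + d.b i)) (N : ℤ)
    (hspan : ∀ i ≥ N, ∀ x ∈ M.deg i, ∃ (s : ℕ) (a : k), x = a • v s) :
    d.point = Quotient.mk (isIsomorphicSetoid (Qgr k (hypGrading w q)))
      ((proj k (hypGrading w q)).obj M) := by
  refine mk_eq_of_torsionIso (d.lift v hv hact) ⟨?_, ?_⟩
  · intro m hm
    suffices h : m = 0 by subst h; exact ⟨0, by simp⟩
    by_contra hm0
    obtain ⟨i, hi⟩ := d.toGrMod.exists_pr_ne_zero hm0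
    have h1 := GrMod.Hom.toLin_pr (d.lift v hv hact) i m
    rw [hm, map_zero] at h1
    by_cases h : ∃ s : ℕ, d.r + d.g * s = i
    · obtain ⟨s, rfl⟩ := h
      obtain ⟨a, ha⟩ := d.mem_deg_iff.1 (d.toGrMod.pr_mem _ m)
      rw [ha, GrMod.Hom.toLin_smul] at h1
      have h2 : GrMod.Hom.toLin (d.lift v hv hact) (d.e s) = v s := d.liftBase_e v s
      rw [h2] at h1
      rw [ha, (smul_eq_zero.1 h1).resolve_right (hv0 s), zero_smul] at hi
      exact hi rfl
    · push Not at h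
      have := d.toGrMod.pr_mem i m
      rw [d.deg_eq_bot h] at this
      exact hi ((Submodule.mem_bot k).1 this)
  · intro m
    induction m using M.induction_homogeneous with
    | hom i m hm =>
      refine ⟨(N - i).toNat, fun j hj r hr => ?_⟩
      obtain ⟨s, a, h⟩ := hspan _ (by omega) _ (M.smul_mem i j m r hm hr)
      refine ⟨a • d.e s, ?_⟩
      rw [GrMod.Hom.toLin_smul, h]
      congr 1
      exact d.liftBase_e v s
    | add x y hx hy =>
      obtain ⟨s, hs⟩ := hx
      obtain ⟨t, ht⟩ := hy
      refine ⟨max s t, fun j hj r hr => ?_⟩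
      rw [smul_add]
      exact add_mem (hs j (le_of_max_le_left hj) r hr) (ht j (le_of_max_le_right hj) r hr)

variable {d}

lemma eq_zero_of_isTors (hw : ∀ i, 0 < w i) {i : ℤ} {m : d.toGrMod.carrier}
    (hm : m ∈ d.toGrMod.deg i) (h : d.toGrMod.IsTors m) : m = 0 := by
  obtain ⟨s, hs⟩ := h
  exact (d.isOneCritical hw).eq_zero_of_torsion hw hm s hs

/-- If `z` kills the components of degree `ρ + D t` of a point module for large `t`, then it does
so for every point module that represents the same point. -/
lemma eventually_smul_eq_zero_of_point_eq (hw : ∀ i, 0 < w i) {d' : PointData w q}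
    (h : d.point = d'.point) (ρ : ℤ) {D : ℕ} (hD : 0 < D) {z : HypAlg w q} {j : ℕ}
    (hz : z ∈ hypGrading w q j)
    (hd : ∀ t : ℕ, ∀ m ∈ d.toGrMod.deg (ρ + D * t), op z • m = 0) :
    ∃ T : ℕ, ∀ t ≥ T, ∀ m ∈ d'.toGrMod.deg (ρ + D * t), op z • m = 0 := by
  obtain ⟨e⟩ := Quotient.exact h
  have hδ : Tendsto (fun t : ℕ => ρ + (D : ℤ) * t) atTop atTop := by
    refine tendsto_atTop_add_const_left _ _ ?_
    exact tendsto_atTop_mono (fun t : ℕ => le_mul_of_one_le_left (Int.natCast_nonneg t)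
      (by exact_mod_cast hD)) tendsto_natCast_atTop_atTop
  have h1 := eventually_isTors_of_iso hw _ hδ z e (Eventually.of_forall fun t m hm => by
    rw [hd t m hm]; exact GrMod.IsTors.zero _)
  obtain ⟨T, hT⟩ := eventually_atTop.1 h1
  exact ⟨T, fun t ht m hm =>
    eq_zero_of_isTors hw (d'.toGrMod.smul_mem _ _ _ _ hm hz) (hT t ht m hm)⟩

end PointData

/-! ### Families of points with at least three active generators -/

namespace PointData

variable (d : PointData w q)

/-- The eigenvalue of `x_i ^ h_i`. -/
def powCoeff (i : Fin n) (s : ℕ) : k := ∏ t ∈ Finset.range (expo w i), d.c i (s + t * d.b i)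

lemma pow_expo_smul_e (i : Fin n) (s : ℕ) :
    op (gen w q i ^ expo w i) • d.e s = d.powCoeff i s • d.e (s + d.period) := by
  rw [op_pow, d.pow_gen_smul_e]
  rcases d.zero_or i with h | h
  · have h0 : ∏ u ∈ Finset.range (expo w i), d.c i (s + u * d.b i) = 0 :=
      Finset.prod_eq_zero (Finset.mem_range.2 (d.expo_pos i)) (h _)
    rw [powCoeff, h0, zero_smul, zero_smul]
  · rw [h.2.2]; rfl

lemma powCoeff_ne_zero {i : Fin n} (hi : ∀ s, d.c i s ≠ 0) (s : ℕ) : d.powCoeff i s ≠ 0 :=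
  Finset.prod_ne_zero_iff.2 fun _ _ => hi _

/-- This is centrality of x_i^{h_i} in coordinates: moving x_l past it produces q_{li}^{h_i} = 1. -/
lemma powCoeff_succ (hq : ∀ i j, q i j ^ expo w j = 1) {l : Fin n} (hl : d.b l = 1) {i : Fin n}
    (hi : ∀ s, d.c i s ≠ 0) (s : ℕ) :
    d.c l s * d.powCoeff i (s + 1) = d.powCoeff i s * d.c l (s + d.period) := by
  have h : ∀ T : ℕ, d.c l s * ∏ t ∈ Finset.range T, d.c i (s + 1 + t * d.b i) =
      q l i ^ T * ((∏ t ∈ Finset.range T, d.c i (s + t * d.b i)) * d.c l (s + T * d.b i)) := by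
    intro T
    induction T with
    | zero => simp
    | succ T ih =>
      have h1 := d.comm i l (s + T * d.b i)
      rw [hl] at h1
      rw [Finset.prod_range_succ, ← mul_assoc, ih, Finset.prod_range_succ, pow_succ]
      rw [show s + 1 + T * d.b i = s + T * d.b i + 1 by ring,
        show s + (T + 1) * d.b i = s + T * d.b i + d.b i by ring]
      linear_combination (q l i ^ T * ∏ t ∈ Finset.range T, d.c i (s + t * d.b i)) * h1
  have h2 := h (expo w i)
  rcases d.zero_or i with h0 | h0
  · exact absurd (h0 0) (hi 0)
  rw [hq, one_mul, h0.2.2] at h2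
  exact h2

/-- The ratio of the eigenvalues of `x_i ^ h_i` and `x_j ^ h_j` is constant. -/
lemma powCoeff_ratio (hq : ∀ i j, q i j ^ expo w j = 1) {l : Fin n} (hl : d.b l = 1)
    (hl0 : ∀ s, d.c l s ≠ 0) {i j : Fin n}
    (hi : ∀ s, d.c i s ≠ 0) (hj : ∀ s, d.c j s ≠ 0) (s : ℕ) :
    d.powCoeff i s * d.powCoeff j 0 = d.powCoeff i 0 * d.powCoeff j s := by
  induction s with
  | zero => rfl
  | succ s ih =>
    refine mul_left_cancel₀ (hl0 s) ?_
    have h1 := d.powCoeff_succ hq hl hi s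
    have h2 := d.powCoeff_succ hq hl hj s
    linear_combination d.powCoeff j 0 * h1 - d.powCoeff i 0 * h2 + d.c l (s + d.period) * ih

/-- Rescaling the action of the generators. -/
def rescale (lam : Fin n → k) (hlam : ∀ i, lam i ≠ 0)
    (h : ∀ s, ∑ i, lam i ^ expo w i * d.powCoeff i s = 0) : PointData w q where
  g := d.g
  r := d.r
  b := d.b
  c i s := lam i * d.c i s
  period := d.period
  g_pos := d.g_pos
  expo_pos := d.expo_pos
  zero_or i := by
    rcases d.zero_or i with h | h
    · exact Or.inl fun s => by rw [h, mul_zero]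
    · exact Or.inr ⟨fun s => mul_ne_zero (hlam i) (h.1 s), h.2⟩
  comm i j s := by
    have := d.comm i j s
    linear_combination lam i * lam j * this
  hyp s := by
    rw [← h s]
    refine Finset.sum_congr rfl fun i _ => ?_
    rw [Finset.prod_mul_distrib, Finset.prod_const, Finset.card_range]
    rfl
  exists_coprime := by
    obtain ⟨i, j, hi, hj, h⟩ := d.exists_coprime
    exact ⟨i, j, fun s => mul_ne_zero (hlam i) (hi s), fun s => mul_ne_zero (hlam j) (hj s), h⟩

lemma powCoeff_rescale (lam : Fin n → k) (hlam : ∀ i, lam i ≠ 0)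
    (h : ∀ s, ∑ i, lam i ^ expo w i * d.powCoeff i s = 0) (i : Fin n) (s : ℕ) :
    (d.rescale lam hlam h).powCoeff i s = lam i ^ expo w i * d.powCoeff i s := by
  change ∏ t ∈ Finset.range (expo w i), lam i * d.c i (s + t * d.b i) = _
  rw [Finset.prod_mul_distrib, Finset.prod_const, Finset.card_range]
  rfl

/-- A point module on which at least three generators act nontrivially moves in an infinite
family. -/
lemma infinite_of_three_active [IsAlgClosed k] (hw : ∀ i, 0 < w i)
    (hexpo : ∀ i, expo w i * w i = ∑ i, w i)
    (hq : ∀ i j, q i j ^ expo w j = 1) {l : Fin n} (hl : d.b l = 1) (hl0 : ∀ s, d.c l s ≠ 0)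
    {x y z : Fin n} (hxy : x ≠ y) (hxz : x ≠ z) (hyz : y ≠ z) (hx : ∀ s, d.c x s ≠ 0)
    (hy : ∀ s, d.c y s ≠ 0) (hz : ∀ s, d.c z s ≠ 0) :
    (ordinaryThinPoints k (hypGrading w q)).Infinite := by
  classical
  set ρ := d.powCoeff x 0 / d.powCoeff z 0 with hρ
  have hx0 := d.powCoeff_ne_zero hx
  have hy0 := d.powCoeff_ne_zero hy
  have hz0 := d.powCoeff_ne_zero hz
  have hρ0 : ρ ≠ 0 := div_ne_zero (hx0 0) (hz0 0)
  have hρs : ∀ s, d.powCoeff x s = ρ * d.powCoeff z s := by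
    intro s
    have := d.powCoeff_ratio hq hl hl0 hx hz s
    rw [hρ, div_mul_eq_mul_div, eq_div_iff (hz0 0), this]
  -- The eigenvalue for `x` is multiplied by τ, that for `y` is kept, and that for `z` compensates.
  -- With eigenvalue ratio ρ the latter must be multiplied by 1 - (τ - 1)ρ, which is nonzero exactly
  -- when τ ≠ 1 + ρ⁻¹.
  have hsol : ∀ τ : k, τ ≠ 0 → τ ≠ 1 + ρ⁻¹ → ∃ d' : PointData w q,
      d'.g = d.g ∧ d'.r = d.r ∧ d'.period = d.period ∧
      (∀ s, d'.powCoeff x s = τ * d.powCoeff x s) ∧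
      (∀ s, d'.powCoeff y s = d.powCoeff y s) := by
    intro τ hτ hτ'
    obtain ⟨α, hα⟩ := IsAlgClosed.exists_pow_nat_eq τ (d.expo_pos x)
    obtain ⟨β, hβ⟩ := IsAlgClosed.exists_pow_nat_eq (1 - (τ - 1) * ρ) (d.expo_pos z)
    have hα0 : α ≠ 0 := by
      rintro rfl
      rw [zero_pow (d.expo_pos x).ne'] at hα
      exact hτ hα.symm
    have hβ0 : β ≠ 0 := by
      rintro rfl
      rw [zero_pow (d.expo_pos z).ne'] at hβ
      apply hτ'
      field_simp
      linear_combination hβ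
    let lam : Fin n → k := fun i => if i = x then α else if i = z then β else 1
    have hlam : ∀ i, lam i ≠ 0 := by
      intro i
      simp only [lam]
      split_ifs
      exacts [hα0, hβ0, one_ne_zero]
    have hsum : ∀ s, ∑ i, lam i ^ expo w i * d.powCoeff i s = 0 := by
      intro s
      have h1 : ∑ i, (lam i ^ expo w i - 1) * d.powCoeff i s = 0 := by
        rw [← Finset.sum_subset (Finset.subset_univ {x, z}), Finset.sum_pair hxz]
        · simp only [lam, if_true, if_neg hxz.symm, hα, hβ, hρs s]
          ring
        · intro i _ hi
          simp only [Finset.mem_insert, Finset.mem_singleton, not_or] at hi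
          simp [lam, hi.1, hi.2]
      have h2 := d.hyp s
      simp only [sub_mul, one_mul, Finset.sum_sub_distrib] at h1
      rw [sub_eq_zero.1 h1]
      exact h2
    refine ⟨d.rescale lam hlam hsum, rfl, rfl, rfl, fun s => ?_, fun s => ?_⟩
    · rw [powCoeff_rescale]; simp [lam, hα]
    · rw [powCoeff_rescale]; simp [lam, hxy.symm, hyz]
  have : Nonempty (PointData w q) := ⟨d⟩
  choose! D hDg hDr hDp hDx hDy using hsol
  have hinf : ({0, 1 + ρ⁻¹}ᶜ : Set k).Infinite := (Set.toFinite _).infinite_compl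
  have hmem : ∀ τ ∈ ({0, 1 + ρ⁻¹}ᶜ : Set k), τ ≠ 0 ∧ τ ≠ 1 + ρ⁻¹ := by
    intro τ hτ
    simpa [not_or] using hτ
  refine (hinf.image (f := fun τ => (D τ).point) ?_).mono ?_
  · intro τ hτ τ' hτ' h
    obtain ⟨h1, h2⟩ := hmem τ hτ
    obtain ⟨h1', h2'⟩ := hmem τ' hτ'
    -- κ is the ratio of the two eigenvalues in the member with parameter τ, so x^{h_x} - κ y^{h_y}
    -- kills that member. On the member with parameter τ' it is τ' - τ times a nonzero scalar.
    set κ := τ * d.powCoeff x 0 / d.powCoeff y 0 with hκ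
    have hκs : ∀ s, κ * d.powCoeff y s = τ * d.powCoeff x s := by
      intro s
      have := d.powCoeff_ratio hq hl hl0 hx hy s
      rw [hκ, div_mul_eq_mul_div, div_eq_iff (hy0 0)]
      linear_combination -τ * this
    have hact : ∀ σ, σ ≠ 0 → σ ≠ 1 + ρ⁻¹ → ∀ s,
        op (gen w q x ^ expo w x - κ • gen w q y ^ expo w y) • (D σ).e s =
          ((σ - τ) * d.powCoeff x s) • (D σ).e (s + d.period) := by
      intro σ hσ hσ' s
      rw [MulOpposite.op_sub, sub_smul, op_smul, smul_assoc, pow_expo_smul_e, pow_expo_smul_e,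
        hDx σ hσ hσ', hDy σ hσ hσ', smul_smul, ← sub_smul, hDp σ hσ hσ', hκs]
      congr 1; ring
    have hz : gen w q x ^ expo w x - κ • gen w q y ^ expo w y ∈ hypGrading w q (∑ i, w i) := by
      refine sub_mem ?_ (Submodule.smul_mem _ _ ?_)
      · rw [← hexpo x]; exact pow_mem_hypGrading (gen_mem x) _
      · rw [← hexpo y]; exact pow_mem_hypGrading (gen_mem y) _
    obtain ⟨T, hT⟩ := eventually_smul_eq_zero_of_point_eq hw h d.r d.g_pos hz (by
      intro t m hm
      rw [← hDr τ h1 h2, ← hDg τ h1 h2] at hm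
      obtain ⟨a, rfl⟩ := (D τ).mem_deg_iff.1 hm
      rw [smul_comm, hact τ h1 h2, sub_self, zero_mul, zero_smul, smul_zero])
    have h3 := hT T le_rfl ((D τ').e T) (by
      rw [← hDr τ' h1' h2', ← hDg τ' h1' h2']; exact (D τ').e_mem T)
    rw [hact τ' h1' h2'] at h3
    have h4 := (smul_eq_zero.1 h3).resolve_right ((D τ').e_ne_zero _)
    exact (sub_eq_zero.1 ((mul_eq_zero.1 h4).resolve_right (hx0 _))).symm
  · rintro _ ⟨τ, -, rfl⟩
    exact (D τ).point_mem hw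

end PointData

end Compare

/-! ### Points with exactly two active generators -/

section Standard

variable {k : Type u} [Field k] {n : ℕ} {w : Fin n → ℕ} {q : Fin n → Fin n → k}

/-- The numerical conditions on the weights and the commutation parameters. -/
structure Admissible (w : Fin n → ℕ) (q : Fin n → Fin n → k) : Prop where
  w_pos : ∀ i, 0 < w i
  expo_mul : ∀ i, expo w i * w i = ∑ j, w j
  q_diag : ∀ i, q i i = 1
  q_inv : ∀ i j, q i j * q j i = 1
  q_left : ∀ i j, q i j ^ expo w i = 1
  q_right : ∀ i j, q i j ^ expo w j = 1
  pair : ∀ i j, i < j → w i ∣ w j ∨ (w i = 4 ∧ w j = 6 ∧ expo w i = 3 ∧ expo w j = 2)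

namespace Admissible

lemma q_ne_zero (h : Admissible w q) (i j : Fin n) : q i j ≠ 0 :=
  left_ne_zero_of_mul_eq_one (h.q_inv i j)

lemma expo_pos (h : Admissible w q) (i : Fin n) : 0 < expo w i := by
  have h1 := h.expo_mul i
  have h2 : 0 < ∑ j, w j :=
    (h.w_pos i).trans_le (Finset.single_le_sum (fun _ _ => Nat.zero_le _) (Finset.mem_univ i))
  exact Nat.pos_of_ne_zero fun h0 => by rw [h0, zero_mul] at h1; omega

end Admissible

variable (w) in
/-- The first generator of a pair acts by this constant in a standard point module. -/
def leadCoeff (k : Type u) [Field k] (i j : Fin n) : k := if w i ∣ w j then 1 else -1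

variable (w q) in
/-- The constant `∏_{t < h_j} q_{ij} ^ (t b_j)`. -/
def twist (i j : Fin n) : k :=
  ∏ t ∈ Finset.range (expo w j), q i j ^ (t * (w j / Nat.gcd (w i) (w j)))

variable (w q) in
/-- The admissible parameters of standard point modules. -/
def IsParam (i j : Fin n) (μ : k) : Prop :=
  if w i ∣ w j then μ ^ expo w j * twist w q i j = -1 else μ = 1

/-- If w_i divides w_j the exponent is 1; otherwise q_{ij} has both cube and square equal to 1, so
it is 1. This lets the constants μ q_{ij}^s satisfy the commutation relation. -/
lemma Admissible.q_pow (h : Admissible w q) {i j : Fin n} (hij : i < j) :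
    q i j ^ (w i / Nat.gcd (w i) (w j)) = q i j := by
  rcases h.pair i j hij with hd | ⟨h1, h2, h3, h4⟩
  · rw [Nat.gcd_eq_left hd, Nat.div_self (h.w_pos i), pow_one]
  · have h5 := h.q_left i j
    have h6 := h.q_right i j
    rw [h3] at h5
    rw [h4] at h6
    have h7 : q i j = 1 := by rw [pow_succ, h6, one_mul] at h5; exact h5
    rw [h7, one_pow]

lemma Admissible.q_eq_one (h : Admissible w q) {i j : Fin n} (hij : i < j) (hd : ¬ w i ∣ w j) :
    q i j = 1 := by
  obtain ⟨-, -, h3, h4⟩ := (h.pair i j hij).resolve_left hd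
  have h5 := h.q_left i j
  have h6 := h.q_right i j
  rw [h3] at h5
  rw [h4] at h6
  rw [pow_succ, h6, one_mul] at h5
  exact h5

lemma IsParam.ne_zero (h : Admissible w q) {i j : Fin n} {μ : k} (hμ : IsParam w q i j μ) :
    μ ≠ 0 := by
  rintro rfl
  rw [IsParam] at hμ
  split_ifs at hμ
  · rw [zero_pow (h.expo_pos j).ne', zero_mul] at hμ
    simp at hμ
  · exact zero_ne_one hμ

/-- The relation f = 0 for a standard point: 1 + (-1) in the divisible case, (-1)^3 + 1^2 for
weights 4 and 6. -/
lemma IsParam.relation (h : Admissible w q) {i j : Fin n} (hij : i < j) {μ : k}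
    (hμ : IsParam w q i j μ) :
    leadCoeff w k i j ^ expo w i + μ ^ expo w j * twist w q i j = 0 := by
  rw [IsParam] at hμ
  rw [leadCoeff]
  split_ifs at hμ ⊢ with hd
  · rw [hμ, one_pow]; ring
  · obtain ⟨-, -, h3, h4⟩ := (h.pair i j hij).resolve_left hd
    rw [twist, h.q_eq_one hij hd, h3, hμ]
    simp
    norm_num

/-- The dependence on `s` enters through (q_{ij}^{h_j})^s = 1, so f imposes the same condition at
every index. -/
lemma prod_range_mul_pow_eq (h : Admissible w q) (i j : Fin n) (μ : k) (s : ℕ) :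
    ∏ t ∈ Finset.range (expo w j), (μ * q i j ^ (s + t * (w j / Nat.gcd (w i) (w j)))) =
      μ ^ expo w j * twist w q i j := by
  simp_rw [pow_add]
  rw [Finset.prod_mul_distrib, Finset.prod_mul_distrib, Finset.prod_const, Finset.prod_const,
    Finset.card_range, ← pow_mul, mul_comm s, pow_mul, h.q_right, one_pow, one_mul, twist]

/-- The standard point module on which exactly the generators `x_i` and `x_j` are active. -/
def std (h : Admissible w q) {i j : Fin n} (hij : i < j) (r : ℤ) {μ : k}
    (hμ : IsParam w q i j μ) : PointData w q where
  g := Nat.gcd (w i) (w j)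
  r := r
  b x := w x / Nat.gcd (w i) (w j)
  c x s := if x = i then leadCoeff w k i j else if x = j then μ * q i j ^ s else 0
  period := (∑ x, w x) / Nat.gcd (w i) (w j)
  g_pos := Nat.gcd_pos_of_pos_left _ (h.w_pos i)
  expo_pos := h.expo_pos
  zero_or x := by
    have h1 : leadCoeff w k i j ≠ 0 := by rw [leadCoeff]; split_ifs <;> simp
    have h2 := hμ.ne_zero h
    have h3 := h.q_ne_zero i j
    have h4 : ∀ x, Nat.gcd (w i) (w j) ∣ w x → w x = Nat.gcd (w i) (w j) *
        (w x / Nat.gcd (w i) (w j)) ∧ expo w x * (w x / Nat.gcd (w i) (w j)) =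
          (∑ x, w x) / Nat.gcd (w i) (w j) := fun x hx =>
      ⟨(Nat.mul_div_cancel' hx).symm, by rw [← h.expo_mul x, Nat.mul_div_assoc _ hx]⟩
    by_cases hi : x = i
    · subst hi
      exact Or.inr ⟨fun s => by simpa using h1, h4 _ (Nat.gcd_dvd_left _ _)⟩
    by_cases hj : x = j
    · subst hj
      exact Or.inr ⟨fun s => by simp [hi, h2, h3], h4 _ (Nat.gcd_dvd_right _ _)⟩
    · exact Or.inl fun s => by simp [hi, hj]
  comm x y s := by
    -- Applying x_i first shifts the exponent of q_{ij} by b_i, a factor q_{ij} by `q_pow`, which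
    -- q_{ji} cancels.
    have h1 := h.q_pow hij
    have h2 := h.q_inv i j
    have h3 := h.q_diag
    by_cases hxi : x = i
    · subst hxi
      by_cases hyi : y = x
      · subst hyi; simp [h3]
      by_cases hyj : y = j
      · subst hyj
        simp only [if_true, if_neg hyi, pow_add, h1]
        linear_combination -(μ * q x y ^ s * leadCoeff w k x y) * h2
      · simp [hyi, hyj]
    by_cases hxj : x = j
    · subst hxj
      by_cases hyi : y = i
      · subst hyi
        simp only [if_true, if_neg hxi, pow_add, h1]
        ring
      by_cases hyj : y = x
      · subst hyj; simp only [h3, one_mul]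
      · simp [hyi, hyj]
    · simp [hxi, hxj]
  hyp s := by
    rw [← Finset.sum_subset (Finset.subset_univ {i, j}), Finset.sum_pair hij.ne]
    · simp only [if_true, if_neg hij.ne']
      rw [Finset.prod_const, Finset.card_range, prod_range_mul_pow_eq h]
      exact hμ.relation h hij
    · intro x _ hx
      simp only [Finset.mem_insert, Finset.mem_singleton, not_or] at hx
      refine Finset.prod_eq_zero (Finset.mem_range.2 (h.expo_pos x)) ?_
      simp [hx.1, hx.2]
  exists_coprime := by
    have h1 : leadCoeff w k i j ≠ 0 := by rw [leadCoeff]; split_ifs <;> simp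
    have h2 := hμ.ne_zero h
    have h3 := h.q_ne_zero i j
    have hg : 0 < Nat.gcd (w i) (w j) := Nat.gcd_pos_of_pos_left _ (h.w_pos i)
    refine ⟨i, j, fun s => by simpa using h1, fun s => by simp [hij.ne', h2, h3], ?_, ?_, ?_⟩
    · exact Nat.div_pos (Nat.le_of_dvd (h.w_pos i) (Nat.gcd_dvd_left _ _)) hg
    · exact Nat.div_pos (Nat.le_of_dvd (h.w_pos j) (Nat.gcd_dvd_right _ _)) hg
    · exact Nat.coprime_div_gcd_div_gcd hg

/-- Shifting the starting degree of a standard point module does not change the point, if the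
structure constants are unchanged. -/
lemma std_point_shift (h : Admissible w q) {i j : Fin n} (hij : i < j) (r : ℤ) {μ : k}
    (hμ : IsParam w q i j μ) (off : ℕ) (hoff : q i j ^ off = 1) :
    (std h hij (r + Nat.gcd (w i) (w j) * off) hμ).point = (std h hij r hμ).point := by
  refine (std h hij (r + Nat.gcd (w i) (w j) * off) hμ).point_eq
    (M := (std h hij r hμ).toGrMod) (fun s => (std h hij r hμ).e (off + s)) (fun s => ?_)
    (fun s => (std h hij r hμ).e_ne_zero _) (fun x s => ?_)
    (r + Nat.gcd (w i) (w j) * off) (fun a ha m hm => ?_)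
  · have := (std h hij r hμ).e_mem (off + s)
    convert this using 2
    change r + (Nat.gcd (w i) (w j) : ℤ) * off + Nat.gcd (w i) (w j) * s =
      r + Nat.gcd (w i) (w j) * ((off + s : ℕ) : ℤ)
    push_cast; ring
  · rw [PointData.gen_smul_e, add_assoc]
    congr 1
    change (if x = i then leadCoeff w k i j else if x = j then μ * q i j ^ (off + s) else 0) =
      (if x = i then leadCoeff w k i j else if x = j then μ * q i j ^ s else 0)
    rw [pow_add, hoff, one_mul]
  · by_cases hs : ∃ s : ℕ, (std h hij r hμ).r + (std h hij r hμ).g * s = a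
    · obtain ⟨s, rfl⟩ := hs
      obtain ⟨c, rfl⟩ := (std h hij r hμ).mem_deg_iff.1 hm
      have hg : (0 : ℤ) < (Nat.gcd (w i) (w j) : ℕ) := by
        exact_mod_cast (std h hij r hμ).g_pos
      have hle : off ≤ s := by
        change r + (Nat.gcd (w i) (w j) : ℤ) * off ≤ r + (Nat.gcd (w i) (w j) : ℤ) * s at ha
        have := le_of_mul_le_mul_left (by linarith :
          (Nat.gcd (w i) (w j) : ℤ) * off ≤ Nat.gcd (w i) (w j) * s) hg
        exact_mod_cast this
      exact ⟨s - off, c, by rw [Nat.add_sub_cancel' hle]⟩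
    · push Not at hs
      rw [(std h hij r hμ).deg_eq_bot hs] at hm
      exact ⟨0, 0, by rw [(Submodule.mem_bot k).1 hm, zero_smul]⟩

/-- The standard point modules represent distinct points. -/
lemma std_point_injective (h : Admissible w q) {i j i' j' : Fin n} (hij : i < j) (hij' : i' < j')
    {r r' : ℕ} (hr : r < Nat.gcd (w i) (w j)) (hr' : r' < Nat.gcd (w i') (w j')) {μ μ' : k}
    (hμ : IsParam w q i j μ) (hμ' : IsParam w q i' j' μ')
    (heq : (std h hij r hμ).point = (std h hij' r' hμ').point) :
    i = i' ∧ j = j' ∧ r = r' ∧ μ = μ' := by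
  -- Testing with z = x_l: an inactive generator kills everything, while an active one kills no
  -- basis vector. The orderings i < j and i' < j' then identify the pairs.
  have hsupp : ∀ l, (l = i ∨ l = j) → (l = i' ∨ l = j') := by
    intro l hl
    by_contra hl'
    rw [not_or] at hl'
    obtain ⟨T, hT⟩ := PointData.eventually_smul_eq_zero_of_point_eq h.w_pos heq.symm r
      (std h hij r hμ).g_pos (gen_mem l) (fun t m hm => by
        clear hm
        induction m using (std h hij' r' hμ').induction_e with
        | smul a s =>
          rw [smul_comm, PointData.gen_smul_e]
          have : (std h hij' r' hμ').c l s = 0 := by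
            change (if l = i' then _ else if l = j' then _ else 0) = (0 : k)
            rw [if_neg hl'.1, if_neg hl'.2]
          rw [this, zero_smul, smul_zero]
        | add x y hx hy => rw [smul_add, hx, hy, add_zero])
    have h1 := hT T le_rfl _ ((std h hij r hμ).e_mem T)
    rw [PointData.gen_smul_e] at h1
    have h2 := (smul_eq_zero.1 h1).resolve_right ((std h hij r hμ).e_ne_zero _)
    have h3 : leadCoeff w k i j ≠ 0 := by rw [leadCoeff]; split_ifs <;> simp
    have h4 : μ * q i j ^ T ≠ 0 := mul_ne_zero (hμ.ne_zero h) (pow_ne_zero _ (h.q_ne_zero i j))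
    change (if l = i then leadCoeff w k i j else if l = j then μ * q i j ^ T else 0) = 0 at h2
    rcases hl with rfl | rfl
    · rw [if_pos rfl] at h2; exact h3 h2
    · rw [if_neg hij.ne', if_pos rfl] at h2; exact h4 h2
  have hi := hsupp i (Or.inl rfl)
  have hj := hsupp j (Or.inr rfl)
  have hii : i = i' ∧ j = j' := by omega
  obtain ⟨rfl, rfl⟩ := hii
  refine ⟨rfl, rfl, ?_⟩
  -- Testing with z = 1 along the degrees congruent to `r`, where a module with a different residue
  -- is zero.
  have hrr : r = r' := by
    by_contra hne
    obtain ⟨T, hT⟩ := PointData.eventually_smul_eq_zero_of_point_eq h.w_pos heq.symm r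
      (std h hij r hμ).g_pos one_mem_hypGrading (fun t m hm => by
        rw [(std h hij' r' hμ').deg_eq_bot] at hm
        · rw [(Submodule.mem_bot k).1 hm, smul_zero]
        · intro s hs
          change (r' : ℤ) + (Nat.gcd (w i) (w j) : ℕ) * s = r + (Nat.gcd (w i) (w j) : ℕ) * t at hs
          have hs' : r' + Nat.gcd (w i) (w j) * s = r + Nat.gcd (w i) (w j) * t := by
            exact_mod_cast hs
          have := congrArg (· % Nat.gcd (w i) (w j)) hs'
          simp only [Nat.add_mul_mod_self_left, Nat.mod_eq_of_lt hr, Nat.mod_eq_of_lt hr'] at this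
          exact hne this.symm)
    have h1 := hT T le_rfl _ ((std h hij r hμ).e_mem T)
    rw [op_one, one_smul] at h1
    exact (std h hij r hμ).e_ne_zero _ h1
  subst hrr
  refine ⟨rfl, ?_⟩
  by_cases hd : w i ∣ w j
  · have hg : Nat.gcd (w i) (w j) = w i := Nat.gcd_eq_left hd
    have hlead : leadCoeff w k i j = 1 := if_pos hd
    -- Testing with x_j - μ x_i^{w_j/w_i} at indices divisible by h_i only, so that q_{ij}^s = 1 and
    -- the bare parameter is visible.
    have hact : ∀ {ν : k} (hν : IsParam w q i j ν) (t : ℕ),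
        op (gen w q j - μ • gen w q i ^ (w j / w i)) • (std h hij r hν).e (expo w i * t) =
          (ν - μ) • (std h hij r hν).e (expo w i * t + w j / w i) := by
      intro ν hν t
      rw [MulOpposite.op_sub, sub_smul, op_smul, smul_assoc, op_pow, PointData.pow_gen_smul_e,
        PointData.gen_smul_e, smul_smul]
      have h1 : (std h hij r hν).c j (expo w i * t) = ν := by
        change (if j = i then leadCoeff w k i j else if j = j then ν * q i j ^ (expo w i * t) else 0)
          = ν
        rw [if_neg hij.ne', if_pos rfl, pow_mul, h.q_left, one_pow, mul_one]
      have h2 : ∀ s, (std h hij r hν).c i s = 1 := fun s => (if_pos rfl).trans hlead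
      have h3 : (std h hij r hν).b j = w j / w i := by
        change w j / Nat.gcd (w i) (w j) = _
        rw [hg]
      have h4 : (std h hij r hν).b i = 1 := by
        change w i / Nat.gcd (w i) (w j) = _
        rw [hg, Nat.div_self (h.w_pos i)]
      rw [h1, h3, h4]
      simp only [h2, Finset.prod_const_one, mul_one]
      rw [sub_smul]
    have hz : gen w q j - μ • gen w q i ^ (w j / w i) ∈ hypGrading w q (w j) := by
      refine sub_mem (gen_mem j) (Submodule.smul_mem _ _ ?_)
      have := pow_mem_hypGrading (gen_mem (w := w) (q := q) i) (w j / w i)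
      rwa [Nat.div_mul_cancel hd] at this
    have hdeg : ∀ {ν : k} (hν : IsParam w q i j ν) (t : ℕ),
        (r : ℤ) + (∑ x, w x : ℕ) * t =
          (std h hij r hν).r + (std h hij r hν).g * (expo w i * t : ℕ) := by
      intro ν hν t
      change _ = (r : ℤ) + (Nat.gcd (w i) (w j) : ℕ) * (expo w i * t : ℕ)
      rw [hg, ← h.expo_mul i]
      push_cast; ring
    have hsum : 0 < ∑ x, w x :=
      (h.w_pos i).trans_le (Finset.single_le_sum (fun _ _ => Nat.zero_le _) (Finset.mem_univ i))
    obtain ⟨T, hT⟩ := PointData.eventually_smul_eq_zero_of_point_eq h.w_pos heq r hsum hz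
      (fun t m hm => by
        rw [hdeg hμ t] at hm
        obtain ⟨a, rfl⟩ := PointData.mem_deg_iff _ |>.1 hm
        rw [smul_comm, hact hμ, sub_self, zero_smul, smul_zero])
    have h1 := hT T le_rfl ((std h hij r hμ').e (expo w i * T)) (by
      rw [hdeg hμ' T]; exact PointData.e_mem _ _)
    rw [hact hμ'] at h1
    exact (sub_eq_zero.1 ((smul_eq_zero.1 h1).resolve_right (PointData.e_ne_zero _ _))).symm
  · rw [IsParam, if_neg hd] at hμ hμ'
    rw [hμ, hμ']

end Standard

/-! ### Classification of critical modules of multiplicity at most one -/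

section Classification

variable {k : Type u} [Field k] {n : ℕ} {w : Fin n → ℕ} {q : Fin n → Fin n → k}

/-- The generator `x_i` acts injectively on homogeneous elements. -/
def GrMod.Active (M : GrMod k (hypGrading w q)) (i : Fin n) : Prop :=
  ∀ d, ∀ m ∈ M.deg d, op (gen w q i) • m = 0 → m = 0

lemma GrMod.Active.pow_smul_ne_zero {M : GrMod k (hypGrading w q)} {i : Fin n} (hi : M.Active i)
    {d : ℤ} {m : M.carrier} (hm : m ∈ M.deg d) (hm0 : m ≠ 0) (t : ℕ) :
    op (gen w q i) ^ t • m ≠ 0 := by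
  induction t generalizing d m with
  | zero => simpa
  | succ t ih =>
    rw [pow_succ, mul_smul]
    exact ih (M.gen_smul_mem hm i) fun h => hm0 (hi d m hm h)

lemma GrMod.pow_smul_mem (M : GrMod k (hypGrading w q)) {d : ℤ} {m : M.carrier}
    (hm : m ∈ M.deg d) (i : Fin n) (t : ℕ) :
    op (gen w q i) ^ t • m ∈ M.deg (d + (t * w i : ℕ)) := by
  rw [← op_pow]
  exact M.smul_mem d _ m _ hm (pow_mem_hypGrading (gen_mem i) t)

lemma GrMod.IsOneCritical.exists_homogeneous_ne_zero {M : GrMod k (hypGrading w q)}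
    (hM : M.IsOneCritical) (N : ℤ) : ∃ d ≥ N, ∃ m ∈ M.deg d, m ≠ 0 := by
  obtain ⟨d, hd, h⟩ := hM.exists_ne_bot N
  exact ⟨d, hd, (Submodule.ne_bot_iff _).1 h⟩

/-- By criticality `v 0` generates all large degrees, and words send each `v s` to multiples of the
`v s'`; surjectivity in large degrees is therefore automatic. -/
lemma GrMod.IsOneCritical.point_eq (hw : ∀ i, 0 < w i) {M : GrMod k (hypGrading w q)}
    (hM : M.IsOneCritical) (d : PointData w q) (v : ℕ → M.carrier)
    (hv : ∀ s : ℕ, v s ∈ M.deg (d.r + d.g * s)) (hv0 : ∀ s, v s ≠ 0)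
    (hact : ∀ i s, op (gen w q i) • v s = d.c i s • v (s + d.b i)) :
    d.point = Quotient.mk (isIsomorphicSetoid (Qgr k (hypGrading w q)))
      ((proj k (hypGrading w q)).obj M) := by
  obtain ⟨N, hN⟩ := hM.eventually_le_span hw (hv 0) (hv0 0)
  have hword : ∀ (l : List (Fin n)) (s : ℕ), op (word w q l) • v s = 0 ∨
      ∃ (a : k) (s' : ℕ), d.g * s' = d.g * s + wt w l ∧ op (word w q l) • v s = a • v s' := by
    intro l
    induction l with
    | nil => exact fun s => Or.inr ⟨1, s, by simp, by simp⟩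
    | cons i l ih =>
      intro s
      rw [word_cons, op_mul, mul_smul, hact, smul_comm]
      rcases d.zero_or i with h | ⟨-, h, -⟩
      · left; rw [h, zero_smul]
      · rcases ih (s + d.b i) with h' | ⟨a, s', h1, h2⟩
        · left; rw [h', smul_zero]
        · refine Or.inr ⟨d.c i s * a, s', ?_, by rw [h2, mul_smul]⟩
          rw [h1, wt_cons, h]; ring
  refine d.point_eq v hv hv0 hact N fun i hi x hx => ?_
  -- The degree determines the index. Fixing it before the induction on the span keeps all summands
  -- multiples of one vector.
  refine ⟨((i - d.r) / d.g).toNat, ?_⟩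
  have h1 := hN i hi x hx
  clear hx
  have hg : (0 : ℤ) < d.g := by exact_mod_cast d.g_pos
  induction h1 using Submodule.span_induction with
  | mem y hy =>
    obtain ⟨l, hl, rfl⟩ := hy
    rcases hword l 0 with h | ⟨a, s', h1, h2⟩
    · exact ⟨0, by rw [h, zero_smul]⟩
    · have h3 : i - d.r = d.g * s' := by
        have : (d.g : ℤ) * s' = d.g * (0 : ℕ) + wt w l := by exact_mod_cast h1
        linarith
      rw [h3, Int.mul_ediv_cancel_left _ hg.ne']
      exact ⟨a, h2⟩
  | zero => exact ⟨0, by rw [zero_smul]⟩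
  | add x y _ _ hx hy =>
    obtain ⟨a, ha⟩ := hx
    obtain ⟨b, hb⟩ := hy
    exact ⟨a + b, by rw [ha, hb, add_smul]⟩
  | smul c x _ hx =>
    obtain ⟨a, ha⟩ := hx
    exact ⟨c * a, by rw [ha, mul_smul]⟩

/-- A critical module of multiplicity at most one with an active generator of weight one gives
rise to the structure constants of a point module. -/
lemma GrMod.IsOneCritical.exists_pointData (h : Admissible w q) {M : GrMod k (hypGrading w q)}
    (hM : M.IsOneCritical) {e : ℝ} (he : M.HasMultiplicity e) (he1 : e ≤ 1)
    (hact : ∀ i, (∀ m : M.carrier, op (gen w q i) • m = 0) ∨ M.Active i)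
    {l : Fin n} (hl : M.Active l) (hwl : w l = 1) :
    ∃ d : PointData w q, d.b = w ∧ ∀ i, M.Active i → ∀ s, d.c i s ≠ 0 := by
  have hmono : ∀ i, M.hilb i ≤ M.hilb (i + 1) := by
    intro i
    have := M.hilb_le_of_injective h.w_pos hl i
    rwa [hwl] at this
  have hle : ∀ i, M.hilb i ≤ 1 := by
    intro i
    have h1 := M.hilb_le_of_hasMultiplicity hM.1 he one_pos hmono i
    have h2 : (M.hilb i : ℝ) ≤ 1 := by push_cast at h1; linarith
    exact_mod_cast h2
  obtain ⟨r, -, hr⟩ := hM.exists_ne_bot 0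
  have hone : ∀ s : ℕ, M.hilb (r + s) = 1 := by
    intro s
    refine le_antisymm (hle _) ?_
    induction s with
    | zero =>
      have := M.finite_deg h.w_pos r
      have : 1 ≤ M.hilb r := Submodule.one_le_finrank_iff.2 hr
      simpa using this
    | succ s ih =>
      refine ih.trans ((hmono _).trans (le_of_eq ?_))
      congr 1; push_cast; ring
  have hbasis : ∀ s : ℕ, ∃ v ∈ M.deg (r + s), v ≠ 0 ∧ ∀ x ∈ M.deg (r + s), ∃ a : k, a • v = x := by
    intro s
    obtain ⟨v, hv, hspan⟩ := finrank_eq_one_iff'.1 (hone s)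
    refine ⟨v.1, v.2, fun h0 => hv (Subtype.ext h0), fun x hx => ?_⟩
    obtain ⟨a, ha⟩ := hspan ⟨x, hx⟩
    exact ⟨a, congrArg Subtype.val ha⟩
  choose v hv hv0 hspan using hbasis
  have hc : ∀ i s, ∃ a : k, a • v (s + w i) = op (gen w q i) • v s := by
    intro i s
    refine hspan _ _ ?_
    have := M.gen_smul_mem (hv s) i
    rwa [add_assoc, ← Nat.cast_add] at this
  choose c hc using hc
  have hcomm : ∀ i j s, c j s * c i (s + w j) = q j i * (c i s * c j (s + w i)) := by
    intro i j s
    have h1 := M.gen_smul_comm i j (v s)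
    rw [← hc j s, ← hc i s, smul_comm, ← hc, smul_comm (op (gen w q j)), ← hc, smul_smul, smul_smul,
      smul_smul, show s + w i + w j = s + w j + w i by ring] at h1
    have h2 := smul_left_injective k (hv0 _) h1
    simpa [mul_assoc] using h2
  have hne : ∀ i, M.Active i → ∀ s, c i s ≠ 0 := by
    intro i hi s h0
    have h1 := hc i s
    rw [h0, zero_smul] at h1
    exact hv0 s (hi _ _ (hv s) h1.symm)
  have hpow : ∀ i T s, op (gen w q i) ^ T • v s =
      (∏ t ∈ Finset.range T, c i (s + t * w i)) • v (s + T * w i) := by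
    intro i T s
    induction T with
    | zero => simp
    | succ T ih =>
      rw [pow_succ', mul_smul, ih, smul_comm, ← hc, smul_smul, Finset.prod_range_succ]
      congr 2; ring
  -- All degrees from `r` on occur, so g = 1 and the steps are the weights; as b_l = 1, the pair (l,
  -- l) already serves as the coprime one.
  refine ⟨⟨1, r, w, c, ∑ j, w j, one_pos, h.expo_pos, fun i => ?_, hcomm, fun s => ?_,
    ⟨l, l, hne l hl, hne l hl, h.w_pos l, h.w_pos l, by rw [hwl]; exact Nat.coprime_one_left 1⟩⟩,
    rfl, hne⟩
  · rcases hact i with h0 | h0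
    · left
      intro s
      have h1 := hc i s
      rw [h0] at h1
      exact (smul_eq_zero.1 h1).resolve_right (hv0 _)
    · exact Or.inr ⟨hne i h0, (one_mul _).symm, h.expo_mul i⟩
  · have h1 := M.sum_gen_pow_smul (v s)
    simp_rw [hpow, h.expo_mul] at h1
    rw [← Finset.sum_smul] at h1
    exact (smul_eq_zero.1 h1).resolve_right (hv0 _)

/-- An eigenvector of f⁻¹g. -/
lemma exists_eigenvector_pair [IsAlgClosed k] {V W : Type*} [AddCommGroup V] [Module k V]
    [AddCommGroup W] [Module k W] [FiniteDimensional k V] [Nontrivial V]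
    (f g : V →ₗ[k] W) (hf : Function.Bijective f) : ∃ (x : V) (μ : k), x ≠ 0 ∧ g x = μ • f x := by
  let e := LinearEquiv.ofBijective f hf
  obtain ⟨μ, hμ⟩ := Module.End.exists_eigenvalue (e.symm.toLinearMap ∘ₗ g)
  obtain ⟨x, hx⟩ := hμ.exists_hasEigenvector
  refine ⟨x, μ, hx.2, ?_⟩
  have h1 : e.symm (g x) = μ • x := hx.apply_eq_smul
  rw [LinearEquiv.symm_apply_eq, map_smul] at h1
  exact h1

/-- The classification when the first weight divides the second. -/
lemma GrMod.IsOneCritical.exists_std_of_dvd [IsAlgClosed k] (h : Admissible w q)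
    {M : GrMod k (hypGrading w q)} (hM : M.IsOneCritical) {e : ℝ} (he : M.HasMultiplicity e)
    (he1 : e ≤ 1) {i j : Fin n} (hij : i < j) (hi : M.Active i) (hj : M.Active j)
    (hoth : ∀ l, l ≠ i → l ≠ j → ∀ m : M.carrier, op (gen w q l) • m = 0) (hd : w i ∣ w j) :
    ∃ r < Nat.gcd (w i) (w j), ∃ (μ : k) (hμ : IsParam w q i j μ),
      Quotient.mk (isIsomorphicSetoid (Qgr k (hypGrading w q)))
        ((proj k (hypGrading w q)).obj M) = (std h hij r hμ).point := by
  have hg : Nat.gcd (w i) (w j) = w i := Nat.gcd_eq_left hd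
  have hwi := h.w_pos i
  obtain ⟨β, hβ⟩ := hd
  have hmono := M.hilb_le_of_injective h.w_pos hi
  have hbd : ∀ a, M.hilb a ≤ w i := by
    intro a
    have h1 := M.hilb_le_of_hasMultiplicity hM.1 he hwi hmono a
    have h2 : (M.hilb a : ℝ) ≤ w i := h1.trans (mul_le_of_le_one_right (Nat.cast_nonneg _) he1)
    exact_mod_cast h2
  -- Multiplicity at most 1 bounds the dimensions by w_i. Beyond `N` the injective x_i is bijective
  -- by dimension.
  obtain ⟨N, hN⟩ := exists_stable_of_bounded hwi hmono (w i) hbd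
  obtain ⟨D₀, hD₀, m₀, hm₀, hne₀⟩ := hM.exists_homogeneous_ne_zero (max N 0)
  have hD0N := le_of_max_le_left hD₀
  have hD00 := le_of_max_le_right hD₀
  obtain ⟨D₀, rfl⟩ := Int.eq_ofNat_of_zero_le hD00
  set r := D₀ % w i with hr
  set ε := D₀ / w i with hε
  have hDdiv : r + w i * ε = D₀ := Nat.mod_add_div _ _
  have hexp := h.expo_pos i
  -- The base degree is raised until its offset from the residue `r` is w_i times a multiple of h_i;
  -- since q_{ij}^{h_i} = 1, the later shift back to `r` leaves the structure constants unchanged.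
  have hD : (D₀ : ℤ) + ((expo w i - 1) * ε * w i : ℕ) = r + w i * (expo w i * ε : ℕ) := by
    obtain ⟨E, hE⟩ := Nat.exists_eq_add_of_lt hexp
    rw [← hDdiv, hE]
    push_cast
    simp
    ring
  set D : ℤ := r + w i * (expo w i * ε : ℕ) with hDdef
  have hDN : N ≤ D := by rw [← hD]; omega
  obtain ⟨y₀, hy₀, hy₀ne⟩ : ∃ y ∈ M.deg D, y ≠ 0 := by
    refine ⟨_, ?_, hi.pow_smul_ne_zero hm₀ hne₀ ((expo w i - 1) * ε)⟩
    rw [← hD]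
    exact M.pow_smul_mem hm₀ i _
  have hstab : ∀ t : ℕ, M.hilb (D + (t * w i : ℕ)) = M.hilb D := by
    intro t
    induction t with
    | zero => simp
    | succ t ih =>
      rw [← ih, ← hN (D + (t * w i : ℕ)) (by omega)]
      congr 1; push_cast; ring
  have := M.finite_deg h.w_pos D
  have := M.finite_deg h.w_pos (D + w j)
  have : Nontrivial (M.deg D) := ⟨⟨y₀, hy₀⟩, 0, fun h0 => hy₀ne (congrArg Subtype.val h0)⟩
  have hwj : (w j : ℤ) = (β * w i : ℕ) := by rw [hβ, mul_comm]
  let φ : M.deg D →ₗ[k] M.deg (D + w j) :=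
    { toFun := fun m => ⟨op (gen w q i) ^ β • m.1, by rw [hwj]; exact M.pow_smul_mem m.2 i β⟩
      map_add' := fun x y => Subtype.ext (smul_add _ _ _)
      map_smul' := fun c x => Subtype.ext (smul_comm _ _ _) }
  let ψ : M.deg D →ₗ[k] M.deg (D + w j) :=
    { toFun := fun m => ⟨op (gen w q j) • m.1, M.gen_smul_mem m.2 j⟩
      map_add' := fun x y => Subtype.ext (smul_add _ _ _)
      map_smul' := fun c x => Subtype.ext (smul_comm _ _ _) }
  have hφ : Function.Injective φ := by
    rw [← LinearMap.ker_eq_bot, LinearMap.ker_eq_bot']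
    rintro ⟨m, hm⟩ h0
    by_contra hm0
    exact hi.pow_smul_ne_zero hm (fun h1 => hm0 (Subtype.ext h1)) β (congrArg Subtype.val h0)
  have hφ' : Function.Surjective φ := by
    refine (LinearMap.injective_iff_surjective_of_finrank_eq_finrank ?_).1 hφ
    have := hstab β
    rw [← hwj] at this
    exact this.symm
  -- The basis is generated from `x` by powers of x_i; the eigenvalue μ of x_j relative to x_i^β
  -- picks up one factor q_{ij} per step.
  obtain ⟨⟨x, hx⟩, μ, hx0, hxμ⟩ := exists_eigenvector_pair φ ψ ⟨hφ, hφ'⟩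
  have hx0 : x ≠ 0 := fun h0 => hx0 (Subtype.ext h0)
  have hxμ : op (gen w q j) • x = μ • op (gen w q i) ^ β • x := congrArg Subtype.val hxμ
  let v : ℕ → M.carrier := fun s => op (gen w q i) ^ s • x
  have hv0 : ∀ s, v s ≠ 0 := hi.pow_smul_ne_zero hx hx0
  have hvi : ∀ s, op (gen w q i) • v s = v (s + 1) := fun s => by
    simp only [v]; rw [← mul_smul, ← pow_succ']
  have hvj : ∀ s, op (gen w q j) • v s = (μ * q i j ^ s) • v (s + β) := by
    intro s
    induction s with
    | zero => simp only [v]; simpa using hxμ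
    | succ s ih =>
      rw [← hvi, M.gen_smul_comm, ih, smul_comm (op (gen w q i)), hvi, smul_smul, pow_succ,
        show s + 1 + β = s + β + 1 by ring]
      congr 1; ring
  have hβ' : w j / Nat.gcd (w i) (w j) = β := by
    rw [hg, hβ, Nat.mul_div_cancel_left _ hwi]
  have hβexp : expo w j * β = expo w i := by
    have h1 := h.expo_mul i
    rw [← h.expo_mul j, hβ] at h1
    exact Nat.eq_of_mul_eq_mul_right hwi (by rw [h1]; ring)
  have hvjp : ∀ T, op (gen w q j) ^ T • v 0 =
      (∏ t ∈ Finset.range T, (μ * q i j ^ (0 + t * β))) • v (T * β) := by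
    intro T
    induction T with
    | zero => simp
    | succ T ih =>
      rw [pow_succ', mul_smul, ih, smul_comm, hvj, smul_smul, Finset.prod_range_succ]
      congr 2
      · rw [zero_add]
      · ring
  have hμ : IsParam w q i j μ := by
    rw [IsParam, if_pos ⟨β, hβ⟩]
    have h1 := M.sum_gen_pow_smul (v 0)
    rw [← Finset.sum_subset (Finset.subset_univ {i, j}), Finset.sum_pair hij.ne, hvjp,
      ← hβ', prod_range_mul_pow_eq h, hβ', hβexp] at h1
    · have h2 : op (gen w q i) ^ expo w i • v 0 = (1 : k) • v (expo w i) := by simp [v]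
      rw [h2, ← add_smul] at h1
      have h3 := (smul_eq_zero.1 h1).resolve_right (hv0 _)
      linear_combination h3
    · intro l _ hl
      simp only [Finset.mem_insert, Finset.mem_singleton, not_or] at hl
      obtain ⟨E, hE⟩ := Nat.exists_eq_add_of_lt (h.expo_pos l)
      rw [hE, pow_succ', mul_smul, hoth l hl.1 hl.2]
  refine ⟨r, by rw [hg]; exact Nat.mod_lt _ hwi, μ, hμ, ?_⟩
  rw [← std_point_shift h hij r hμ (expo w i * ε) (by rw [pow_mul, h.q_left, one_pow])]
  refine (hM.point_eq h.w_pos (std h hij _ hμ) v (fun s => ?_) hv0 (fun l s => ?_)).symm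
  · change v s ∈ M.deg ((r : ℤ) + (Nat.gcd (w i) (w j) : ℕ) * (expo w i * ε : ℕ) +
      (Nat.gcd (w i) (w j) : ℕ) * s)
    rw [hg]
    have := M.pow_smul_mem hx i s
    rw [Nat.cast_mul, mul_comm] at this
    exact this
  · change op (gen w q l) • v s = (if l = i then leadCoeff w k i j else
      if l = j then μ * q i j ^ s else 0) • v (s + w l / Nat.gcd (w i) (w j))
    split_ifs with hli hlj
    · subst hli
      rw [hvi, hg, Nat.div_self hwi, leadCoeff, if_pos ⟨β, hβ⟩, one_smul]
    · subst hlj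
      rw [hvj, hβ']
    · rw [hoth l hli hlj, zero_smul]

/-- The classification for weights `4` and `6`. -/
lemma GrMod.IsOneCritical.exists_std_of_not_dvd (h : Admissible w q)
    {M : GrMod k (hypGrading w q)} (hM : M.IsOneCritical)
    {i j : Fin n} (hij : i < j) (hi : M.Active i) (hj : M.Active j)
    (hoth : ∀ l, l ≠ i → l ≠ j → ∀ m : M.carrier, op (gen w q l) • m = 0) (hd : ¬ w i ∣ w j) :
    ∃ r < Nat.gcd (w i) (w j), ∃ (μ : k) (hμ : IsParam w q i j μ),
      Quotient.mk (isIsomorphicSetoid (Qgr k (hypGrading w q)))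
        ((proj k (hypGrading w q)).obj M) = (std h hij r hμ).point := by
  obtain ⟨h4, h6, he3, he2⟩ := (h.pair i j hij).resolve_left hd
  have hq1 := h.q_eq_one hij hd
  have hg : Nat.gcd (w i) (w j) = 2 := by rw [h4, h6]; rfl
  obtain ⟨D₀, hD₀, x, hx, hx0⟩ := hM.exists_homogeneous_ne_zero 0
  obtain ⟨D₀, rfl⟩ := Int.eq_ofNat_of_zero_le hD₀
  have hcomm : ∀ m : M.carrier, op (gen w q j) • op (gen w q i) • m =
      op (gen w q i) • op (gen w q j) • m := by
    intro m
    rw [M.gen_smul_comm, hq1, one_smul]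
  have hcommp : ∀ (t : ℕ) (m : M.carrier), op (gen w q j) • op (gen w q i) ^ t • m =
      op (gen w q i) ^ t • op (gen w q j) • m := by
    intro t m
    induction t with
    | zero => simp
    | succ t ih => rw [pow_succ', mul_smul, hcomm, ih, mul_smul]
  have hsq : ∀ m : M.carrier, op (gen w q j) • op (gen w q j) • m =
      -(op (gen w q i) ^ 3 • m) := by
    intro m
    have h1 := M.sum_gen_pow_smul m
    rw [← Finset.sum_subset (Finset.subset_univ {i, j}), Finset.sum_pair hij.ne, he3, he2,
      pow_two, mul_smul] at h1
    · exact (neg_eq_of_add_eq_zero_right h1).symm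
    · intro l _ hl
      simp only [Finset.mem_insert, Finset.mem_singleton, not_or] at hl
      obtain ⟨E, hE⟩ := Nat.exists_eq_add_of_lt (h.expo_pos l)
      rw [hE, pow_succ', mul_smul, hoth l hl.1 hl.2]
  -- Words in x_i, x_j reach relative degrees 0, 4, 6, 8, …, so the regular part starts at 4 and `v
  -- s` has relative degree 4 + 2s. The signs are chosen so that x_j acts by 1 and x_i by -1,
  -- compatibly with x_j^2 = -x_i^3.
  let v : ℕ → M.carrier := fun s => if s % 2 = 0 then
      (-1 : k) ^ (s / 2 + 1) • op (gen w q i) ^ (s / 2 + 1) • x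
    else (-1 : k) ^ (s / 2) • op (gen w q i) ^ (s / 2) • op (gen w q j) • x
  have hve : ∀ t, v (2 * t) = (-1 : k) ^ (t + 1) • op (gen w q i) ^ (t + 1) • x := by
    intro t
    simp only [v]
    rw [if_pos (by omega), show 2 * t / 2 = t by omega]
  have hvo : ∀ t, v (2 * t + 1) = (-1 : k) ^ t • op (gen w q i) ^ t • op (gen w q j) • x := by
    intro t
    simp only [v]
    rw [if_neg (by omega), show (2 * t + 1) / 2 = t by omega]
  have hjx0 : op (gen w q j) • x ≠ 0 := fun h0 => hx0 (hj _ _ hx h0)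
  have hsign : ∀ t, (-1 : k) ^ t ≠ 0 := fun t => pow_ne_zero _ (by simp)
  have hv0 : ∀ s, v s ≠ 0 := by
    intro s
    rcases Nat.even_or_odd' s with ⟨t, rfl | rfl⟩
    · rw [hve]; exact smul_ne_zero (hsign _) (hi.pow_smul_ne_zero hx hx0 _)
    · rw [hvo]
      exact smul_ne_zero (hsign _) (hi.pow_smul_ne_zero (M.gen_smul_mem hx j) hjx0 _)
  have hvi : ∀ s, op (gen w q i) • v s = (-1 : k) • v (s + 2) := by
    intro s
    rcases Nat.even_or_odd' s with ⟨t, rfl | rfl⟩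
    · rw [show 2 * t + 2 = 2 * (t + 1) by ring, hve, hve, smul_comm, ← mul_smul, ← pow_succ',
        smul_smul]
      congr 1; ring
    · rw [show 2 * t + 1 + 2 = 2 * (t + 1) + 1 by ring, hvo, hvo, smul_comm, ← mul_smul,
        ← pow_succ', smul_smul (-1 : k)]
      congr 1; ring
  have hvj : ∀ s, op (gen w q j) • v s = (1 : k) • v (s + 3) := by
    intro s
    rw [one_smul]
    rcases Nat.even_or_odd' s with ⟨t, rfl | rfl⟩
    · rw [show 2 * t + 3 = 2 * (t + 1) + 1 by ring, hve, hvo, smul_comm, hcommp]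
    · rw [show 2 * t + 1 + 3 = 2 * (t + 2) by ring, hve, hvo, smul_comm, hcommp, hsq, smul_neg,
        ← mul_smul, ← pow_add, smul_neg, ← neg_smul]
      congr 1; ring
  have hμ : IsParam w q i j 1 := by rw [IsParam, if_neg hd]
  refine ⟨(D₀ + 4) % 2, by rw [hg]; omega, 1, hμ, ?_⟩
  rw [← std_point_shift h hij _ hμ ((D₀ + 4) / 2) (by rw [hq1, one_pow])]
  refine (hM.point_eq h.w_pos (std h hij _ hμ) v (fun s => ?_) hv0 (fun l s => ?_)).symm
  · change v s ∈ M.deg ((((D₀ + 4) % 2 : ℕ) : ℤ) + (Nat.gcd (w i) (w j) : ℕ) * ((D₀ + 4) / 2 : ℕ) +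
      (Nat.gcd (w i) (w j) : ℕ) * s)
    rw [hg]
    rcases Nat.even_or_odd' s with ⟨t, rfl | rfl⟩
    · rw [hve]
      refine Submodule.smul_mem _ _ ?_
      have := M.pow_smul_mem hx i (t + 1)
      rw [h4] at this
      convert this using 2
      omega
    · rw [hvo]
      refine Submodule.smul_mem _ _ ?_
      have := M.pow_smul_mem (M.gen_smul_mem hx j) i t
      rw [h4, h6] at this
      convert this using 2
      omega
  · change op (gen w q l) • v s = (if l = i then leadCoeff w k i j else
      if l = j then 1 * q i j ^ s else 0) • v (s + w l / Nat.gcd (w i) (w j))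
    split_ifs with hli hlj
    · subst hli
      rw [hvi, hg, h4, leadCoeff, if_neg hd]
    · subst hlj
      rw [hvj, hg, h6, hq1, one_pow, mul_one]
    · rw [hoth l hli hlj, zero_smul]

/-- Every ordinary or thin point is standard, provided that there are only finitely many. -/
lemma exists_std_of_finite [IsAlgClosed k] (h : Admissible w q)
    (hthree : ∀ x y z : Fin n, x ≠ y → x ≠ z → y ≠ z → w x = 1 ∨ w y = 1 ∨ w z = 1)
    (hfin : (ordinaryThinPoints k (hypGrading w q)).Finite)
    {M : GrMod k (hypGrading w q)} (hM : M.IsOneCritical) {e : ℝ} (he : M.HasMultiplicity e)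
    (he1 : e ≤ 1) :
    ∃ (i j : Fin n) (hij : i < j), ∃ r < Nat.gcd (w i) (w j), ∃ (μ : k) (hμ : IsParam w q i j μ),
      Quotient.mk (isIsomorphicSetoid (Qgr k (hypGrading w q)))
        ((proj k (hypGrading w q)).obj M) = (std h hij r hμ).point := by
  have hact : ∀ i, (∀ m : M.carrier, op (gen w q i) • m = 0) ∨ M.Active i :=
    hM.gen_smul_eq_zero_or h.w_pos h.q_ne_zero
  obtain ⟨D, -, m, hm, hm0⟩ := hM.exists_homogeneous_ne_zero 0
  have hone : ∃ i, M.Active i := by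
    by_contra! hnone
    refine hm0 (hM.eq_zero_of_torsion h.w_pos hm 1 fun l hl => ?_)
    cases l with
    | nil => simp at hl
    | cons i l =>
      rw [word_cons, op_mul, mul_smul, (hact i).resolve_right (hnone i), smul_zero]
  obtain ⟨i, hi⟩ := hone
  have htwo : ∃ j, j ≠ i ∧ M.Active j := by
    by_contra! hnone
    have h1 := M.sum_gen_pow_smul m
    -- With a single active generator, f = 0 would reduce to x_i^{h_i} = 0, against injectivity.
    rw [Finset.sum_eq_single i] at h1
    · exact hi.pow_smul_ne_zero hm hm0 _ h1
    · intro j _ hj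
      obtain ⟨E, hE⟩ := Nat.exists_eq_add_of_lt (h.expo_pos j)
      rw [hE, pow_succ', mul_smul, (hact j).resolve_right (hnone j hj)]
    · exact fun h2 => absurd (Finset.mem_univ i) h2
  obtain ⟨j, hji, hj⟩ := htwo
  have hoth : ∀ l, l ≠ i → l ≠ j → ∀ m : M.carrier, op (gen w q l) • m = 0 := by
    intro l hli hlj
    refine (hact l).resolve_right fun hl => ?_
    have hweight : ∃ x, M.Active x ∧ w x = 1 := by
      rcases hthree i j l hji.symm hli.symm hlj.symm with h1 | h1 | h1
      exacts [⟨i, hi, h1⟩, ⟨j, hj, h1⟩, ⟨l, hl, h1⟩]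
    obtain ⟨x, hx, hwx⟩ := hweight
    obtain ⟨d, hdb, hd⟩ := hM.exists_pointData h he he1 hact hx hwx
    exact d.infinite_of_three_active h.w_pos h.expo_mul h.q_right (l := x) (by rw [hdb, hwx])
      (hd x hx) hji.symm hli.symm hlj.symm (hd i hi) (hd j hj) (hd l hl) hfin
  have key : ∀ {i j : Fin n} (hij : i < j), M.Active i → M.Active j →
      (∀ l, l ≠ i → l ≠ j → ∀ m : M.carrier, op (gen w q l) • m = 0) →
      ∃ r < Nat.gcd (w i) (w j), ∃ (μ : k) (hμ : IsParam w q i j μ),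
        Quotient.mk (isIsomorphicSetoid (Qgr k (hypGrading w q)))
          ((proj k (hypGrading w q)).obj M) = (std h hij r hμ).point := by
    intro i j hij hi hj hoth
    by_cases hd : w i ∣ w j
    · exact hM.exists_std_of_dvd h he he1 hij hi hj hoth hd
    · exact hM.exists_std_of_not_dvd h hij hi hj hoth hd
  rcases lt_or_gt_of_ne hji with hlt | hlt
  · exact ⟨j, i, hlt, key hlt hj hi fun l h1 h2 => hoth l h2 h1⟩
  · exact ⟨i, j, hlt, key hlt hi hj hoth⟩

end Classification

/-! ### Counting the standard points -/

section Count

variable {k : Type u} [Field k] {n : ℕ} {w : Fin n → ℕ} {q : Fin n → Fin n → k}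

/-- In characteristic 0 the polynomial X^m - c is separable, so its m roots are distinct. -/
lemma ncard_pow_eq [IsAlgClosed k] [CharZero k] {m : ℕ} (hm : 0 < m) {c : k} (hc : c ≠ 0) :
    {μ : k | μ ^ m = c}.ncard = m := by
  classical
  have hset : {μ : k | μ ^ m = c} = ((Polynomial.nthRoots m c).toFinset : Set k) := by
    ext μ
    simp [Polynomial.mem_nthRoots hm]
  have hsep : (Polynomial.X ^ m - Polynomial.C c : Polynomial k).Separable :=
    Polynomial.separable_X_pow_sub_C c (by exact_mod_cast hm.ne') hc
  rw [hset, Set.ncard_coe_finset, Polynomial.nthRoots,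
    Multiset.toFinset_card_of_nodup (Polynomial.nodup_roots hsep),
    IsAlgClosed.card_roots_eq_natDegree, Polynomial.natDegree_X_pow_sub_C]

lemma twist_ne_zero (h : Admissible w q) (i j : Fin n) : twist w q i j ≠ 0 :=
  Finset.prod_ne_zero_iff.2 fun _ _ => pow_ne_zero _ (h.q_ne_zero i j)

lemma ncard_isParam [IsAlgClosed k] [CharZero k] (h : Admissible w q) (i j : Fin n) :
    {μ : k | IsParam w q i j μ}.ncard = if w i ∣ w j then expo w j else 1 := by
  have ht := twist_ne_zero h i j
  split_ifs with hd
  · rw [← ncard_pow_eq (h.expo_pos j) (c := -1 / twist w q i j) (div_ne_zero (by simp) ht)]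
    congr 1
    ext μ
    change IsParam w q i j μ ↔ μ ^ expo w j = _
    rw [IsParam, if_pos hd, eq_div_iff ht]
  · have : {μ : k | IsParam w q i j μ} = {1} := by
      ext μ
      change IsParam w q i j μ ↔ _
      rw [IsParam, if_neg hd, Set.mem_singleton_iff]
    rw [this, Set.ncard_singleton]

/-- The number of ordinary and thin points, if it is finite. -/
lemma ncard_ordinaryThinPoints [IsAlgClosed k] [CharZero k] (h : Admissible w q)
    (hthree : ∀ x y z : Fin n, x ≠ y → x ≠ z → y ≠ z → w x = 1 ∨ w y = 1 ∨ w z = 1)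
    (hfin : (ordinaryThinPoints k (hypGrading w q)).Finite) :
    (ordinaryThinPoints k (hypGrading w q)).ncard =
      ∑ p : Fin n × Fin n with p.1 < p.2, Nat.gcd (w p.1) (w p.2) *
        if w p.1 ∣ w p.2 then expo w p.2 else 1 := by
  classical
  have hpfin : ∀ p : Fin n × Fin n, {μ : k | IsParam w q p.1 p.2 μ}.Finite := fun p => by
    -- Infinite sets have `ncard` 0, so the positive count already proves finiteness.
    refine Set.finite_of_ncard_pos ?_
    rw [ncard_isParam h]
    split_ifs
    exacts [h.expo_pos _, one_pos]
  let P : Finset (Σ _ : Fin n × Fin n, ℕ × k) :=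
    (Finset.univ.filter fun p : Fin n × Fin n => p.1 < p.2).sigma fun p =>
      Finset.range (Nat.gcd (w p.1) (w p.2)) ×ˢ (hpfin p).toFinset
  have hP : ∀ x, x ∈ P ↔ x.1.1 < x.1.2 ∧ x.2.1 < Nat.gcd (w x.1.1) (w x.1.2) ∧
      IsParam w q x.1.1 x.1.2 x.2.2 := by
    intro x
    simp [P]
  let F : (x : Σ _ : Fin n × Fin n, ℕ × k) → x ∈ P →
      Quotient (isIsomorphicSetoid (Qgr k (hypGrading w q))) := fun x hx =>
    (std h ((hP x).1 hx).1 x.2.1 ((hP x).1 hx).2.2).point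
  rw [Set.ncard_eq_toFinset_card _ hfin]
  rw [← Finset.card_bij (s := P) F]
  · rw [Finset.card_sigma]
    refine Finset.sum_congr rfl fun p _ => ?_
    rw [Finset.card_product, Finset.card_range, ← Set.ncard_eq_toFinset_card _ (hpfin p),
      ncard_isParam h]
  · intro x hx
    rw [Set.Finite.mem_toFinset]
    exact PointData.point_mem _ h.w_pos
  · intro x hx y hy hxy
    obtain ⟨⟨i, j⟩, r, μ⟩ := x
    obtain ⟨⟨i', j'⟩, r', μ'⟩ := y
    obtain ⟨rfl, rfl, rfl, rfl⟩ := std_point_injective h ((hP _).1 hx).1 ((hP _).1 hy).1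
      ((hP _).1 hx).2.1 ((hP _).1 hy).2.1 ((hP _).1 hx).2.2 ((hP _).1 hy).2.2 hxy
    rfl
  · intro x hx
    rw [Set.Finite.mem_toFinset] at hx
    obtain ⟨M, hM, ⟨e, he, he1⟩, rfl⟩ := hx
    obtain ⟨i, j, hij, r, hr, μ, hμ, heq⟩ := exists_std_of_finite h hthree hfin hM he he1
    exact ⟨⟨(i, j), r, μ⟩, (hP _).2 ⟨hij, hr, hμ⟩, heq.symm⟩

end Count

end QuantumWeighted
end

/-! ### The five weight vectors and the final count. -/

/-- The weights for which both `a` and `b` divide `2 + a + b`. -/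
lemma weights_eq {a b : ℕ} (ha : 0 < a) (hab : a ≤ b) (hda : a ∣ 1 + 1 + a + b)
    (hdb : b ∣ 1 + 1 + a + b) :
    (a = 1 ∧ b = 1) ∨ (a = 1 ∧ b = 3) ∨ (a = 2 ∧ b = 2) ∨ (a = 2 ∧ b = 4) ∨ (a = 4 ∧ b = 6) := by
  obtain ⟨t, ht⟩ := hdb
  have hb : b ∣ 2 + a := (Nat.dvd_add_left (dvd_refl b)).1 ⟨t, by omega⟩
  obtain ⟨s, hs⟩ := hb
  have hs1 : s ≠ 0 := by rintro rfl; omega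
  -- Here b s = 2 + a ≤ 2 + b, so s ≥ 2 gives b ≤ 2, and s = 1 gives b = a + 2 with a dividing 4.
  by_cases h2 : 2 ≤ s
  · have : b * 2 ≤ b * s := Nat.mul_le_mul_left b h2
    have hb2 : b ≤ 2 := by omega
    have ha2 : a ≤ 2 := by omega
    interval_cases b <;> interval_cases a <;> omega
  · have : s = 1 := by omega
    subst this
    have hb : b = a + 2 := by omega
    have ha4 : a ∣ 4 := by
      rw [hb] at hda
      have h3 : a ∣ 4 + 2 * a := by convert hda using 1; ring
      exact (Nat.dvd_add_left (dvd_mul_left a 2)).1 h3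
    have := Nat.le_of_dvd (by norm_num) ha4
    interval_cases a <;> omega

theorem mainTheorem9 {k : Type*} [Field k] [IsAlgClosed k] [CharZero k]
    (a b : ℕ) (ha : 0 < a) (hab : a ≤ b)
    (hda : a ∣ 1 + 1 + a + b) (hdb : b ∣ 1 + 1 + a + b)
    (q : Fin 4 → Fin 4 → k)
    (hq_diag : ∀ i, q i i = 1)
    (hq_inv : ∀ i j, q i j * q j i = 1)
    (hq_left : ∀ i j, q i j ^ QuantumWeighted.expo ![1, 1, a, b] i = 1)
    (hq_right : ∀ i j, q i j ^ QuantumWeighted.expo ![1, 1, a, b] j = 1)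
    (hfin : (QuantumWeighted.ordinaryThinPoints k
      (QuantumWeighted.hypGrading ![1, 1, a, b] q)).Finite) :
    (QuantumWeighted.ordinaryThinPoints k
      (QuantumWeighted.hypGrading ![1, 1, a, b] q)).ncard = 24 := by
  rcases weights_eq ha hab hda hdb with
    ⟨rfl, rfl⟩ | ⟨rfl, rfl⟩ | ⟨rfl, rfl⟩ | ⟨rfl, rfl⟩ | ⟨rfl, rfl⟩
  -- The weight conditions and the sum are finite checks. For weights (1,1,4,6), with h =
  -- (12,12,3,2), the sum is 12 + 3 + 2 + 3 + 2 + 2.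
  all_goals
    rw [QuantumWeighted.ncard_ordinaryThinPoints ⟨by decide, by decide, hq_diag, hq_inv, hq_left,
      hq_right, by decide⟩ (by decide) hfin]
    decide
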